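/- Let $n\ge 1$ and let $\Sigma$ be one of the simply connected space forms $\mathbb{E}^{n+1}$, $\mathbb{S}^{n+1}$, $\mathbb{H}^{n+1}$ of constant sectional curvature $0$, $1$, $-1$ respectively. Let $M\subset\Sigma$ be a smooth oriented hypersurface (embedded or, more generally, immersed) with unit normal field $\nu$, second fundamental form $h(V,W)=\langle D_VW,\nu\rangle$, Weingarten map $A$ and mean curvature $H=\operatorname{tr}A$, and suppose that $H$ is constant. Let $$T=\Delta+\mathrm{Rc}_\Sigma(\nu,\nu)+\operatorname{tr}(A^2)$$ be the stability operator, where $\Delta$ is the Laplace–Beltrami operator of the induced metric on $M$ and $\mathrm{Rc}_\Sigma$ is the Ricci curvature of $\Sigma$. An open subset $U\subset M$ is called *strongly stable* if for every open connected set $\Omega\subset U$ and every $f\in C_c^\infty(\Omega)$ which is not identically zero and satisfies $\int_M f=0$ there holds $$-\int_\Omega f\,T(f)>0,$$ where the integrals are taken with respect to the Riemannian measure of the induced metric. (i) If $\Sigma=\mathbb{E}^{n+1}$ or $\Sigma=\mathbb{S}^{n+1}$, then every $p\in M$ has a strongly stable open neighbourhood $U\subset M$. (ii) If $\Sigma=\mathbb{H}^{n+1}$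 and $M$ is not contained in a horosphere, then there exists a point $p\in M$ which has a strongly stable open neighbourhood $U\subset M$. -/

import Mathlib

open scoped Manifold ContDiff Topology
open MeasureTheory

namespace SpaceFormStability

/-- A Riemannian manifold realised as a submanifold `carrier` of the coordinate space `ℝᴺ`, whose
metric is the restriction of the symmetric bilinear form `form`; for `x` in `carrier`, `proj x` is
the `form`-orthogonal projection of `ℝᴺ` onto the tangent space at `x`.  Only the three instances
`euclidean`, `spherical` and `hyperbolic` below are used. -/
structure ModelSpace (N : ℕ) where
  /-- The points of the space. -/
  carrier : Set (EuclideanSpace ℝ (Fin N))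
  /-- The ambient bilinear form inducing the metric. -/
  form : EuclideanSpace ℝ (Fin N) →L[ℝ] EuclideanSpace ℝ (Fin N) →L[ℝ] ℝ
  /-- The projection onto the tangent space at a point. -/
  proj : EuclideanSpace ℝ (Fin N) → EuclideanSpace ℝ (Fin N) →L[ℝ] EuclideanSpace ℝ (Fin N)

/-- The standard inner product `⟨x, y⟩ = ∑ xᵢ yᵢ` on `ℝᴺ`, as a bilinear form. -/
noncomputable def dot (N : ℕ) :
    EuclideanSpace ℝ (Fin N) →L[ℝ] EuclideanSpace ℝ (Fin N) →L[ℝ] ℝ :=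
  innerSL ℝ

theorem dot_apply (N : ℕ) (x y : EuclideanSpace ℝ (Fin N)) : dot N x y = ∑ i, x i * y i := by
  have h : dot N x y = inner ℝ x y := rfl
  rw [h, PiLp.inner_apply]
  simp [mul_comm]

/-- Euclidean space `𝔼ⁿ⁺¹`. -/
noncomputable def euclidean (n : ℕ) : ModelSpace (n + 1) where
  carrier := Set.univ
  form := dot (n + 1)
  proj := fun _ => ContinuousLinearMap.id ℝ _

/-- The unit sphere `𝕊ⁿ⁺¹ ⊂ ℝⁿ⁺²`; the tangent space at `x` is the orthogonal complement of `x`. -/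
noncomputable def spherical (n : ℕ) : ModelSpace (n + 2) where
  carrier := Metric.sphere 0 1
  form := dot (n + 2)
  proj := fun x => ContinuousLinearMap.id ℝ _ - (dot (n + 2) x).smulRight x

/-- The Lorentz form `-x₀y₀ + x₁y₁ + … + xₙ₊₁yₙ₊₁` on `ℝⁿ⁺²`. -/
noncomputable def lorentz (n : ℕ) :
    EuclideanSpace ℝ (Fin (n + 2)) →L[ℝ] EuclideanSpace ℝ (Fin (n + 2)) →L[ℝ] ℝ :=
  dot (n + 2) - (2 : ℝ) • (EuclideanSpace.proj (0 : Fin (n + 2)) :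
    EuclideanSpace ℝ (Fin (n + 2)) →L[ℝ] ℝ).smulRight
      (EuclideanSpace.proj (0 : Fin (n + 2)) : EuclideanSpace ℝ (Fin (n + 2)) →L[ℝ] ℝ)

theorem lorentz_apply (n : ℕ) (x y : EuclideanSpace ℝ (Fin (n + 2))) :
    lorentz n x y = -(x 0 * y 0) + ∑ i : Fin (n + 1), x i.succ * y i.succ := by
  simp [lorentz, dot_apply, Fin.sum_univ_succ (n := n + 1)]
  ring

/-- Hyperbolic space `ℍⁿ⁺¹` in the hyperboloid model `⟨x, x⟩ = -1`, `x₀ > 0`; the tangent space at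
`x` is the Lorentz-orthogonal complement of `x`. -/
noncomputable def hyperbolic (n : ℕ) : ModelSpace (n + 2) where
  carrier := {x | lorentz n x x = -1 ∧ 0 < x 0}
  form := lorentz n
  proj := fun x => ContinuousLinearMap.id ℝ _ + (lorentz n x).smulRight x

/-- A horosphere of `ℍⁿ⁺¹`: the intersection of the hyperboloid with an affine hyperplane
`⟨x, l⟩ = -1`, where `l` is a future-pointing null vector. -/
def IsHorosphere (n : ℕ) (A : Set (EuclideanSpace ℝ (Fin (n + 2)))) : Prop :=
  ∃ l : EuclideanSpace ℝ (Fin (n + 2)), lorentz n l l = 0 ∧ 0 < l 0 ∧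
    A = {x | x ∈ (hyperbolic n).carrier ∧ lorentz n x l = -1}

section Curvature

variable {N : ℕ} (S : ModelSpace N)

/-- The Levi-Civita connection `D_X Y` of the space: the tangential part of the directional
derivative, for vector fields tangent to the space (extended to `ℝᴺ`). -/
noncomputable def connection (X Y : EuclideanSpace ℝ (Fin N) → EuclideanSpace ℝ (Fin N))
    (x : EuclideanSpace ℝ (Fin N)) : EuclideanSpace ℝ (Fin N) :=
  S.proj x (fderiv ℝ Y x (X x))

/-- The curvature `R(X,Y)Z = D_X D_Y Z - D_Y D_X Z - D_[X,Y] Z`. -/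
noncomputable def curvature (X Y Z : EuclideanSpace ℝ (Fin N) → EuclideanSpace ℝ (Fin N))
    (x : EuclideanSpace ℝ (Fin N)) : EuclideanSpace ℝ (Fin N) :=
  connection S X (connection S Y Z) x - connection S Y (connection S X Z) x
    - connection S (VectorField.lieBracket ℝ X Y) Z x

/-- A vector `v`, extended to a tangential vector field by projection. -/
noncomputable def tangentField (v : EuclideanSpace ℝ (Fin N)) :
    EuclideanSpace ℝ (Fin N) → EuclideanSpace ℝ (Fin N) :=
  fun y => S.proj y v

/-- The Ricci curvature `Rc(u, w)` at `x` of tangent vectors `u`, `w`: the trace of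
`v ↦ R(v, u) w` on the tangent space at `x`, computed as the trace over `ℝᴺ` of
`v ↦ R(proj x v, u) w`. -/
noncomputable def ricci (x u w : EuclideanSpace ℝ (Fin N)) : ℝ :=
  ∑ i : Fin N,
    (curvature S (tangentField S (EuclideanSpace.single i 1)) (tangentField S u)
      (tangentField S w) x) i

end Curvature

section Hypersurface

variable {n N : ℕ} {M : Type*} [TopologicalSpace M]
  [ChartedSpace (EuclideanSpace ℝ (Fin n)) M]

/-- The differential at `x` of a map `Y : M → ℝᴺ`, with the tangent space of `M` at `x` written as
`ℝⁿ` (to which it is definitionally equal). -/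
noncomputable def differential (Y : M → EuclideanSpace ℝ (Fin N)) (x : M) :
    EuclideanSpace ℝ (Fin n) →L[ℝ] EuclideanSpace ℝ (Fin N) :=
  mfderiv (𝓡 n) 𝓘(ℝ, EuclideanSpace ℝ (Fin N)) Y x

/-- The differential at `x` of a function `f : M → ℝ`. -/
noncomputable def differentialReal (f : M → ℝ) (x : M) : EuclideanSpace ℝ (Fin n) →L[ℝ] ℝ :=
  mfderiv (𝓡 n) 𝓘(ℝ, ℝ) f x

/-- `F : M → ℝᴺ` is a smooth immersion of the `n`-manifold `M` into the space `S`, and `ν` is a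
smooth unit normal field along it, tangent to `S`.  (It is a hypersurface when `S` has
dimension `n + 1`.) -/
structure IsOrientedHypersurface (S : ModelSpace N) (F ν : M → EuclideanSpace ℝ (Fin N)) :
    Prop where
  smooth : ContMDiff (𝓡 n) 𝓘(ℝ, EuclideanSpace ℝ (Fin N)) ∞ F
  mem_carrier : ∀ x, F x ∈ S.carrier
  immersion : ∀ x, Function.Injective (differential (n := n) F x)
  normal_smooth : ContMDiff (𝓡 n) 𝓘(ℝ, EuclideanSpace ℝ (Fin N)) ∞ ν
  normal_tangent : ∀ x, S.proj (F x) (ν x) = ν x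
  normal_unit : ∀ x, S.form (ν x) (ν x) = 1
  normal_orthogonal : ∀ x v, S.form (ν x) (differential (n := n) F x v) = 0

variable (S : ModelSpace N) (F ν : M → EuclideanSpace ℝ (Fin N))

/-- The induced metric `g` on `M` at `x`. -/
noncomputable def metric (x : M) :
    EuclideanSpace ℝ (Fin n) →L[ℝ] EuclideanSpace ℝ (Fin n) →L[ℝ] ℝ :=
  S.form.bilinearComp (differential F x) (differential F x)

/-- The tangent vector `v` at `x` dual to the covector `a`, that is `g(v, w) = a w` for all `w`. -/
noncomputable def sharp (x : M) :
    (EuclideanSpace ℝ (Fin n) →L[ℝ] ℝ) →L[ℝ] EuclideanSpace ℝ (Fin n) :=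
  (metric S F x).inverse

/-- The orthogonal projection of a vector `w` of `ℝᴺ` onto the tangent space of `M` at `x`: the
tangent vector `v` with `g(v, v') = ⟨w, dF v'⟩` for all `v'`. -/
noncomputable def tangentPart (x : M) :
    EuclideanSpace ℝ (Fin N) →L[ℝ] EuclideanSpace ℝ (Fin n) :=
  (sharp S F x).comp
    (((ContinuousLinearMap.compL ℝ (EuclideanSpace ℝ (Fin n)) (EuclideanSpace ℝ (Fin N)) ℝ).flip
      (differential F x)).comp S.form)

/-- The gradient of `f` with respect to the induced metric, as a vector of `ℝᴺ`. -/
noncomputable def gradient (f : M → ℝ) (x : M) : EuclideanSpace ℝ (Fin N) :=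
  differential (n := n) F x (sharp S F x (differentialReal f x))

/-- The Levi-Civita derivative `v ↦ ∇_v Y` on `M` of a tangential field `Y : M → ℝᴺ`: the
tangential part of the derivative. -/
noncomputable def covariantDeriv (Y : M → EuclideanSpace ℝ (Fin N)) (x : M) :
    EuclideanSpace ℝ (Fin n) →L[ℝ] EuclideanSpace ℝ (Fin n) :=
  (tangentPart S F x).comp (differential Y x)

/-- The Laplace-Beltrami operator `Δ f = div ∇ f = tr (v ↦ ∇_v ∇ f)` of the induced metric. -/
noncomputable def laplacian (f : M → ℝ) (x : M) : ℝ :=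
  LinearMap.trace ℝ (EuclideanSpace ℝ (Fin n))
    (covariantDeriv (n := n) S F (gradient (n := n) S F f) x).toLinearMap

/-- The Weingarten map `A v = -D_v ν`; it satisfies `g(A V, W) = ⟨D_V W, ν⟩`. -/
noncomputable def weingarten (x : M) :
    EuclideanSpace ℝ (Fin n) →L[ℝ] EuclideanSpace ℝ (Fin n) :=
  -(tangentPart S F x).comp (differential ν x)

/-- The mean curvature `H = tr A`. -/
noncomputable def meanCurvature (x : M) : ℝ :=
  LinearMap.trace ℝ (EuclideanSpace ℝ (Fin n)) (weingarten (n := n) S F ν x).toLinearMap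

/-- `M` has constant mean curvature. -/
def HasConstantMeanCurvature : Prop :=
  ∃ c : ℝ, ∀ x, meanCurvature (n := n) S F ν x = c

/-- The stability operator `T f = Δ f + Rc(ν, ν) f + tr(A²) f`. -/
noncomputable def stabilityOperator (f : M → ℝ) (x : M) : ℝ :=
  laplacian (n := n) S F f x + ricci S (F x) (ν x) (ν x) * f x
    + LinearMap.trace ℝ (EuclideanSpace ℝ (Fin n))
        ((weingarten (n := n) S F ν x).comp (weingarten (n := n) S F ν x)).toLinearMap * f x

/-- The Gram matrix `g_{ij}` of the induced metric in the chart `e`, at `y` in the target of `e`. -/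
noncomputable def gramMatrix (e : OpenPartialHomeomorph M (EuclideanSpace ℝ (Fin n)))
    (y : EuclideanSpace ℝ (Fin n)) : Matrix (Fin n) (Fin n) ℝ :=
  Matrix.of fun i j => S.form
    (fderiv ℝ (F ∘ e.symm) y (EuclideanSpace.single i 1))
    (fderiv ℝ (F ∘ e.symm) y (EuclideanSpace.single j 1))

/-- The Riemannian measure of the induced metric: the smallest measure which dominates, for every
smooth chart, the image of `√(det g_{ij}) dy` under the inverse of the chart.  (As these images
agree on overlaps of charts, it restricts to each of them on the domain of the chart.) -/
noncomputable def riemannianMeasure [MeasurableSpace M] : Measure M :=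
  ⨆ e ∈ IsManifold.maximalAtlas (𝓡 n) ∞ M,
    ((volume.restrict e.target).withDensity
      fun y => ENNReal.ofReal √(gramMatrix S F e y).det).map e.symm

/-- The open subset `U` of the hypersurface `M` (which is assumed to have constant mean curvature)
is, as a hypersurface in its own right, strongly stable: `-∫_Ω f T(f) > 0` for all open connected
`Ω ⊆ U` and all `f ∈ C_c^∞(Ω)`, not identically zero, with mean value zero.  Functions in
`C_c^∞(Ω)` are extended by zero to `M`. -/
def StronglyStable [MeasurableSpace M] (U : Set M) : Prop :=
  ∀ Ω : Set M, Ω ⊆ U → IsOpen Ω → IsConnected Ω →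
    ∀ f : M → ℝ, ContMDiff (𝓡 n) 𝓘(ℝ, ℝ) ∞ f → HasCompactSupport f → tsupport f ⊆ Ω →
      (∃ x, f x ≠ 0) → ∫ x, f x ∂(riemannianMeasure (n := n) S F) = 0 →
      0 < -∫ x in Ω, f x * stabilityOperator (n := n) S F ν f x ∂(riemannianMeasure (n := n) S F)

end Hypersurface

end SpaceFormStability

/-! On a small enough ball the Dirichlet energy dominates any bounded potential. Green's identity
turns `-∫ f T f` into `∫ |∇f|² - ∫ V f²`, where `V = Rc(ν, ν) + tr A²` is continuous and hence
locally bounded. By Poincaré's inequality, on a coordinate ball of radius `r` the first integral is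
at least a constant times `r⁻² ∫ f²`. For small `r` the difference is therefore positive for every
nonzero test function supported in the ball. This works around every point of a hypersurface whose
induced metric is positive definite: `exists_ball_integral_neg` is the statement in coordinates,
`exists_stronglyStable_nhds` the one on `M`.

Most of the work connects the extrinsic definitions with coordinates. Green's identity comes from
the divergence formula `ρ div X = ∑ ∂ᵢ(ρ Xⁱ)` with `ρ = √det g`
(`volumeDensity_mul_trace_covariantDeriv`), which rests on Jacobi's formula for `det` and on the
symmetry of second derivatives. The Laplacian and `tr A²` are transported to a chart by naturality,
and the supremum defining the Riemannian measure is identified with `ρ dy` in a chart by the change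
of variables formula (`riemannianMeasure_restrict_source`).

The space forms enter through three facts: the form is symmetric, the tangential projection is
smooth, and the induced metric is positive definite. In `ℍⁿ⁺¹` the last holds because tangent
vectors are Lorentz-orthogonal to a timelike vector. There a point must also be produced: the empty
hypersurface lies in every horosphere, so `M` is nonempty. -/

namespace SpaceFormStability


/-! ### Jacobi's formula. -/

section MatrixCalculus

/-- Jacobi's formula for the derivative of a determinant. -/
theorem hasDerivAt_det {ι : Type*} [Fintype ι] [DecidableEq ι] {A : ℝ → Matrix ι ι ℝ}
    {A' : Matrix ι ι ℝ} {t : ℝ} (h : ∀ i j, HasDerivAt (fun s => A s i j) (A' i j) t) :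
    HasDerivAt (fun s => (A s).det) ((A t).adjugate * A').trace t := by
  have key : HasDerivAt (fun s => (A s).det)
      (∑ σ : Equiv.Perm ι, ((Equiv.Perm.sign σ : ℤ) : ℝ) *
        ∑ i, (∏ j ∈ Finset.univ.erase i, A t (σ j) j) • A' (σ i) i) t := by
    simp_rw [Matrix.det_apply']
    refine HasDerivAt.fun_sum fun σ _ => ?_
    refine HasDerivAt.const_mul _ ?_
    exact HasDerivAt.fun_finsetProd fun i _ => h (σ i) i
  convert key using 1
  -- Cramer's rule: each diagonal entry is the determinant with one column differentiated, matching
  -- the Leibniz rule applied to the permutation expansion.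
  have h1 : ∀ i, ((A t).adjugate * A') i i = ((A t).updateCol i fun k => A' k i).det := by
    intro i
    rw [← Matrix.cramer_apply, Matrix.cramer_eq_adjugate_mulVec]
    rfl
  simp_rw [Matrix.trace, Matrix.diag_apply, h1, Matrix.det_apply', Finset.mul_sum]
  rw [Finset.sum_comm]
  refine Finset.sum_congr rfl fun σ _ => Finset.sum_congr rfl fun i _ => ?_
  rw [← Finset.mul_prod_erase _ _ (Finset.mem_univ i)]
  simp only [Matrix.updateCol_self, smul_eq_mul]
  rw [mul_comm (A' (σ i) i)]
  congr 2
  refine Finset.prod_congr rfl fun j hj => ?_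
  rw [Matrix.updateCol_ne (Finset.ne_of_mem_erase hj)]

end MatrixCalculus

/-! ### Integration by parts and Poincaré's inequality in `ℝⁿ`. -/

section EuclideanAnalysis

variable {n : ℕ}

theorem trace_eq_sum_single (A : EuclideanSpace ℝ (Fin n) →ₗ[ℝ] EuclideanSpace ℝ (Fin n)) :
    LinearMap.trace ℝ _ A = ∑ i, A (EuclideanSpace.single i 1) i := by
  rw [LinearMap.trace_eq_sum_inner A (EuclideanSpace.basisFun (Fin n) ℝ)]
  refine Finset.sum_congr rfl fun i _ => ?_
  rw [EuclideanSpace.basisFun_apply, EuclideanSpace.inner_single_left]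
  simp

/-- The product of a continuous function supported in an open set and a function that is continuous
on that set is continuous. -/
theorem continuous_mul_of_tsupport_subset {X : Type*} [TopologicalSpace X] {O : Set X}
    (hO : IsOpen O) {u h : X → ℝ} (hu : Continuous u) (hs : tsupport u ⊆ O)
    (hh : ContinuousOn h O) : Continuous fun x => u x * h x := by
  refine continuous_of_tsupport fun x hx => ?_
  have hxO : x ∈ O := hs (tsupport_mul_subset_left hx)
  exact hu.continuousAt.mul (hh.continuousAt (hO.mem_nhds hxO))

theorem integrable_mul_of_tsupport_subset {X : Type*} [TopologicalSpace X] [MeasurableSpace X]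
    [OpensMeasurableSpace X] {μ : Measure X} [IsFiniteMeasureOnCompacts μ] {O : Set X}
    (hO : IsOpen O) {u h : X → ℝ} (hu : Continuous u) (hc : HasCompactSupport u)
    (hs : tsupport u ⊆ O) (hh : ContinuousOn h O) : Integrable (fun x => u x * h x) μ :=
  (continuous_mul_of_tsupport_subset hO hu hs hh).integrable_of_hasCompactSupport hc.mul_right

theorem _root_.HasCompactSupport.sq {X : Type*} [TopologicalSpace X] {u : X → ℝ}
    (hc : HasCompactSupport u) : HasCompactSupport fun x => u x ^ 2 :=
  hc.comp_left (g := fun t : ℝ => t ^ 2) (by simp)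

theorem _root_.Continuous.integrable_sq_of_hasCompactSupport {X : Type*} [TopologicalSpace X]
    [MeasurableSpace X] [OpensMeasurableSpace X] {μ : Measure X} [IsFiniteMeasureOnCompacts μ]
    {u : X → ℝ} (hu : Continuous u) (hc : HasCompactSupport u) :
    Integrable (fun x => u x ^ 2) μ :=
  (hu.pow 2).integrable_of_hasCompactSupport hc.sq

/-- Integration by parts for the divergence of a vector field defined on an open set containing the
compact support of `u`. -/
theorem integral_mul_trace_fderiv {O : Set (EuclideanSpace ℝ (Fin n))} (hO : IsOpen O)
    {u : EuclideanSpace ℝ (Fin n) → ℝ} (hu : ContDiff ℝ ∞ u) (hc : HasCompactSupport u)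
    (hs : tsupport u ⊆ O) {X : EuclideanSpace ℝ (Fin n) → EuclideanSpace ℝ (Fin n)}
    (hX : ContDiffOn ℝ ∞ X O) :
    ∫ y, u y * LinearMap.trace ℝ _ (fderiv ℝ X y).toLinearMap = -∫ y, fderiv ℝ u y (X y) := by
  have hXi : ∀ i, ContDiffOn ℝ ∞ (fun y => X y i) O := fun i => (contDiffOn_piLp 2).1 hX i
  have hdX : ∀ y ∈ O, ∀ i v, fderiv ℝ (fun z => X z i) y v = fderiv ℝ X y v i := by
    intro y hy i v
    have hd : HasFDerivAt X (fderiv ℝ X y) y :=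
      ((hX.contDiffAt (hO.mem_nhds hy)).differentiableAt (by simp)).hasFDerivAt
    exact congrArg (fun L : EuclideanSpace ℝ (Fin n) →L[ℝ] ℝ => L v)
      ((EuclideanSpace.proj i : EuclideanSpace ℝ (Fin n) →L[ℝ] ℝ).hasFDerivAt.comp y hd).fderiv
  have hdu : Continuous (fderiv ℝ u) := hu.continuous_fderiv (by simp)
  have hduc : ∀ v, Continuous fun y => fderiv ℝ u y v := fun v => hdu.clm_apply continuous_const
  have hdusupp : ∀ v, tsupport (fun y => fderiv ℝ u y v) ⊆ tsupport u := fun v =>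
    tsupport_fderiv_apply_subset ℝ v
  have hducs : ∀ v, HasCompactSupport fun y => fderiv ℝ u y v := fun v =>
    hc.of_isClosed_subset (isClosed_tsupport _) (hdusupp v)
  have hDXi : ∀ i v, ContinuousOn (fun y => fderiv ℝ (fun z => X z i) y v) O := fun i v =>
    ((hXi i).continuousOn_fderiv_of_isOpen hO (by simp)).clm_apply continuousOn_const
  have hint1 : ∀ i v, Integrable (fun y => u y * fderiv ℝ (fun z => X z i) y v) := fun i v =>
    integrable_mul_of_tsupport_subset hO hu.continuous hc hs (hDXi i v)
  have hint2 : ∀ i v, Integrable (fun y => fderiv ℝ u y v * X y i) := fun i v =>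
    integrable_mul_of_tsupport_subset hO (hduc v) (hducs v) ((hdusupp v).trans hs)
      (hXi i).continuousOn
  have hparts : ∀ i v, ∫ y, u y * fderiv ℝ (fun z => X z i) y v
      = -∫ y, fderiv ℝ u y v * X y i := by
    intro i v
    refine integral_mul_fderiv_eq_neg_fderiv_mul_of_integrable (hint2 i v) (hint1 i v)
      (integrable_mul_of_tsupport_subset hO hu.continuous hc hs (hXi i).continuousOn)
      (fun y _ => hu.differentiable (by simp) y) fun y hy => ?_
    exact ((hXi i).contDiffAt (hO.mem_nhds (hs hy))).differentiableAt (by simp)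
  have e1 : ∀ y, u y * LinearMap.trace ℝ _ (fderiv ℝ X y).toLinearMap
      = ∑ i, u y * fderiv ℝ (fun z => X z i) y (EuclideanSpace.single i 1) := by
    intro y
    by_cases hy : u y = 0
    · simp [hy]
    · rw [trace_eq_sum_single, Finset.mul_sum]
      refine Finset.sum_congr rfl fun i _ => ?_
      rw [hdX y (hs (subset_tsupport _ hy))]
      rfl
  have e2 : ∀ y, fderiv ℝ u y (X y)
      = ∑ i, fderiv ℝ u y (EuclideanSpace.single i 1) * X y i := by
    intro y
    have hy := (EuclideanSpace.basisFun (Fin n) ℝ).sum_repr (X y)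
    conv_lhs => rw [← hy]
    simp [map_sum, mul_comm]
  simp_rw [e1, e2]
  rw [integral_finsetSum _ fun i _ => hint1 i _, integral_finsetSum _ fun i _ => hint2 i _,
    ← Finset.sum_neg_distrib]
  exact Finset.sum_congr rfl fun i _ => hparts i _

/-- Poincaré's inequality in a slab. -/
theorem integral_sq_le_integral_fderiv_sq (i : Fin n) {u : EuclideanSpace ℝ (Fin n) → ℝ}
    (hu : ContDiff ℝ ∞ u) (hc : HasCompactSupport u) {y₀ : EuclideanSpace ℝ (Fin n)} {r : ℝ}
    (hs : tsupport u ⊆ Metric.ball y₀ r) :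
    ∫ y, u y ^ 2 ≤ 4 * r ^ 2 * ∫ y, fderiv ℝ u y (EuclideanSpace.single i 1) ^ 2 := by
  set v : EuclideanSpace ℝ (Fin n) := EuclideanSpace.single i 1 with hv
  have hdu : Continuous fun y => fderiv ℝ u y v :=
    (hu.continuous_fderiv (by simp)).clm_apply continuous_const
  have hducs : HasCompactSupport fun y => fderiv ℝ u y v :=
    hc.of_isClosed_subset (isClosed_tsupport _) (tsupport_fderiv_apply_subset ℝ v)
  have hu2 : ContDiff ℝ ∞ fun y => u y ^ 2 := hu.pow 2
  have hu2c : HasCompactSupport fun y => u y ^ 2 := hc.sq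
  have hi1 : Integrable fun y => u y ^ 2 := hu.continuous.integrable_sq_of_hasCompactSupport hc
  have hi2 : Integrable fun y => fderiv ℝ u y v ^ 2 := hdu.integrable_sq_of_hasCompactSupport hducs
  have hl : ∀ y, HasFDerivAt (fun y : EuclideanSpace ℝ (Fin n) => y i - y₀ i)
      (EuclideanSpace.proj i : EuclideanSpace ℝ (Fin n) →L[ℝ] ℝ) y := fun y =>
    (EuclideanSpace.proj i : EuclideanSpace ℝ (Fin n) →L[ℝ] ℝ).hasFDerivAt.sub_const _
  have hlc : Continuous fun y : EuclideanSpace ℝ (Fin n) => y i - y₀ i := by fun_prop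
  have hd2 : ∀ y, fderiv ℝ (fun y => u y ^ 2) y v = u y * (2 * fderiv ℝ u y v) := by
    intro y
    rw [((hu.differentiable (by simp) y).hasFDerivAt.pow 2).fderiv]
    simp
    ring
  have hi3 : Integrable fun y => fderiv ℝ (fun y => u y ^ 2) y v * (y i - y₀ i) := by
    simp_rw [hd2, mul_assoc]
    exact (hu.continuous.mul (continuous_const.mul (hdu.mul hlc))).integrable_of_hasCompactSupport
      hc.mul_right
  -- The factor `1` in `∫ u² · 1` is the derivative of `yᵢ - y₀ᵢ` along `v`, and this function is
  -- bounded by `r` on the support of `u`.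
  have hparts := integral_mul_fderiv_eq_neg_fderiv_mul_of_integrable (𝕜 := ℝ)
    (μ := (volume : Measure (EuclideanSpace ℝ (Fin n))))
    (f := fun y => u y ^ 2) (g := fun y => y i - y₀ i) (v := v) hi3
    (by simpa [(hl _).fderiv, hv] using hi1)
    ((hu2.continuous.mul hlc).integrable_of_hasCompactSupport hu2c.mul_right)
    (fun y _ => hu2.differentiable (by simp) y) (fun y _ => (hl y).differentiableAt)
  have hone : ∀ y, fderiv ℝ (fun y : EuclideanSpace ℝ (Fin n) => y i - y₀ i) y v = 1 := by
    intro y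
    rw [(hl y).fderiv]
    simp [hv]
  simp_rw [hone, mul_one] at hparts
  rw [← integral_neg] at hparts
  -- Young's inequality is weighted so that half of `∫ u²` can be absorbed on the left; this
  -- produces the constant `4 r²`.
  have hle : ∫ y, u y ^ 2 ≤ ∫ y, (1 / 2 * u y ^ 2 + 2 * r ^ 2 * fderiv ℝ u y v ^ 2) := by
    rw [hparts]
    refine integral_mono hi3.neg ((hi1.const_mul _).add (hi2.const_mul _)) fun y => ?_
    simp only [hd2]
    by_cases hy : u y = 0
    · simp only [hy]
      have : 0 ≤ 2 * r ^ 2 * fderiv ℝ u y v ^ 2 := by positivity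
      simpa using this
    · have hyb : dist y y₀ < r := hs (subset_tsupport _ hy)
      have hb : |y i - y₀ i| ≤ r := by
        have := PiLp.norm_apply_le (y - y₀) i
        rw [← dist_eq_norm] at this
        simp only [PiLp.sub_apply, Real.norm_eq_abs] at this
        linarith
      have hsq : (y i - y₀ i) ^ 2 ≤ r ^ 2 := sq_le_sq' (by linarith [abs_le.1 hb]) (abs_le.1 hb).2
      have h1 : (y i - y₀ i) ^ 2 * fderiv ℝ u y v ^ 2 ≤ r ^ 2 * fderiv ℝ u y v ^ 2 := by gcongr
      nlinarith [sq_nonneg (u y + 2 * ((y i - y₀ i) * fderiv ℝ u y v))]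
  rw [integral_add (hi1.const_mul _) (hi2.const_mul _), integral_const_mul,
    integral_const_mul] at hle
  linarith

end EuclideanAnalysis


/-! ### Linear algebra of the induced metric at a point. -/

section PointwiseGeometry

variable {n N : ℕ} {M : Type*} [TopologicalSpace M]
  [ChartedSpace (EuclideanSpace ℝ (Fin n)) M] {S : ModelSpace N} {F : M → EuclideanSpace ℝ (Fin N)}
  {x : M}

/-- The metric induced by `F` is positive definite at `x`. -/
def IsSpacelikeAt (S : ModelSpace N) (F : M → EuclideanSpace ℝ (Fin N)) (x : M) : Prop :=
  ∀ v : EuclideanSpace ℝ (Fin n), v ≠ 0 → 0 < S.form (differential F x v) (differential F x v)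

theorem metric_apply (v w : EuclideanSpace ℝ (Fin n)) :
    metric S F x v w = S.form (differential F x v) (differential F x w) := rfl

/-- Positive definiteness gives injectivity, and a finite-dimensional space and its dual have equal
dimension. Since `ContinuousLinearMap.inverse` is zero on non-invertible maps, this is what makes
`sharp` the true musical isomorphism. -/
theorem IsSpacelikeAt.metric_isInvertible (h : IsSpacelikeAt (n := n) S F x) :
    (metric (n := n) S F x).IsInvertible := by
  have hinj : Function.Injective (metric (n := n) S F x).toLinearMap := by
    rw [injective_iff_map_eq_zero]
    intro v hv
    by_contra hne
    have h1 := h v hne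
    have h2 : metric S F x v v = 0 := by
      have : metric S F x v = 0 := hv
      rw [this]
      rfl
    rw [metric_apply] at h2
    exact h1.ne' h2
  have hdim : Module.finrank ℝ (EuclideanSpace ℝ (Fin n))
      = Module.finrank ℝ (EuclideanSpace ℝ (Fin n) →L[ℝ] ℝ) := by
    rw [← (LinearMap.toContinuousLinearMap (𝕜 := ℝ) (E := EuclideanSpace ℝ (Fin n))
      (F' := ℝ)).finrank_eq]
    exact (Subspace.dual_finrank_eq (K := ℝ) (V := EuclideanSpace ℝ (Fin n))).symm
  refine ⟨((metric (n := n) S F x).toLinearMap.linearEquivOfInjective hinj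
    hdim).toContinuousLinearEquiv, ?_⟩
  ext v w
  rfl

theorem IsSpacelikeAt.metric_sharp (h : IsSpacelikeAt (n := n) S F x)
    (a : EuclideanSpace ℝ (Fin n) →L[ℝ] ℝ) : metric S F x (sharp S F x a) = a :=
  h.metric_isInvertible.self_apply_inverse a

theorem IsSpacelikeAt.sharp_metric (h : IsSpacelikeAt (n := n) S F x)
    (v : EuclideanSpace ℝ (Fin n)) : sharp S F x (metric S F x v) = v :=
  h.metric_isInvertible.inverse_apply_self v

theorem tangentPart_apply (w : EuclideanSpace ℝ (Fin N)) :
    tangentPart (n := n) S F x w = sharp S F x ((S.form w).comp (differential F x)) := rfl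

theorem IsSpacelikeAt.tangentPart_differential (h : IsSpacelikeAt (n := n) S F x)
    (v : EuclideanSpace ℝ (Fin n)) : tangentPart S F x (differential F x v) = v :=
  h.sharp_metric v

theorem IsSpacelikeAt.metric_tangentPart (h : IsSpacelikeAt (n := n) S F x)
    (w : EuclideanSpace ℝ (Fin N)) (v : EuclideanSpace ℝ (Fin n)) :
    metric S F x (tangentPart S F x w) v = S.form w (differential F x v) := by
  rw [tangentPart_apply, h.metric_sharp]
  rfl

/-- The matrix of the induced metric at `x` in the standard basis of `ℝⁿ`. -/
noncomputable def metricMatrix (S : ModelSpace N) (F : M → EuclideanSpace ℝ (Fin N)) (x : M) :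
    Matrix (Fin n) (Fin n) ℝ :=
  Matrix.of fun i j => metric S F x (EuclideanSpace.single i 1) (EuclideanSpace.single j 1)

theorem sum_smul_single (v : EuclideanSpace ℝ (Fin n)) :
    ∑ i, v i • (EuclideanSpace.single i 1 : EuclideanSpace ℝ (Fin n)) = v := by
  simpa using (EuclideanSpace.basisFun (Fin n) ℝ).sum_repr v

theorem bilin_apply_eq_sum
    (B : EuclideanSpace ℝ (Fin n) →L[ℝ] EuclideanSpace ℝ (Fin n) →L[ℝ] ℝ)
    (v w : EuclideanSpace ℝ (Fin n)) : B v w = ∑ i, ∑ j, v i * w j *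
      B (EuclideanSpace.single i 1) (EuclideanSpace.single j 1) := by
  conv_lhs => rw [← sum_smul_single v, ← sum_smul_single w]
  simp only [map_sum, map_smul, FunLike.coe_sum, Finset.sum_apply, FunLike.coe_smul, Pi.smul_apply,
    smul_eq_mul, Finset.mul_sum]
  rw [Finset.sum_comm]
  refine Finset.sum_congr rfl fun i _ => Finset.sum_congr rfl fun j _ => ?_
  ring

/-- The Cauchy-Schwarz inequality for a positive semidefinite bilinear form. -/
theorem bilin_sq_le (B : EuclideanSpace ℝ (Fin n) →L[ℝ] EuclideanSpace ℝ (Fin n) →L[ℝ] ℝ)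
    (hs : ∀ v w, B v w = B w v) (hp : ∀ v, 0 ≤ B v v) (v w : EuclideanSpace ℝ (Fin n)) :
    B w v ^ 2 ≤ B v v * B w w := by
  -- Expansion of `B (t v + w) (t v + w)`; a quadratic that is nowhere negative has nonpositive
  -- discriminant.
  have key : ∀ t : ℝ, 0 ≤ B v v * (t * t) + 2 * B w v * t + B w w := by
    intro t
    have := hp (t • v + w)
    simp only [map_add, map_smul, FunLike.coe_add, Pi.add_apply, FunLike.coe_smul, Pi.smul_apply,
      smul_eq_mul, hs v w] at this
    linarith
  have := discrim_le_zero key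
  rw [discrim] at this
  linarith

theorem metricMatrix_transpose (hS : ∀ a b, S.form a b = S.form b a) :
    (metricMatrix (n := n) S F x).transpose = metricMatrix S F x := by
  ext i j
  exact hS _ _

theorem IsSpacelikeAt.posDef_metricMatrix (h : IsSpacelikeAt (n := n) S F x)
    (hS : ∀ a b, S.form a b = S.form b a) : (metricMatrix (n := n) S F x).PosDef := by
  refine Matrix.PosDef.of_dotProduct_mulVec_pos ?_ fun v hv => ?_
  · ext i j
    exact hS _ _
  · have hw : WithLp.toLp 2 v ≠ 0 := by simpa using hv
    have := h _ hw
    rw [← metric_apply, bilin_apply_eq_sum] at this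
    refine this.trans_eq ?_
    symm
    simp only [dotProduct, Matrix.mulVec, metricMatrix, Matrix.of_apply, star_trivial,
      Finset.mul_sum]
    refine Finset.sum_congr rfl fun i _ => Finset.sum_congr rfl fun j _ => ?_
    ring

/-- The trace of the tangential part of a linear map, in terms of the Gram matrix. -/
theorem IsSpacelikeAt.det_mul_trace_tangentPart_comp (h : IsSpacelikeAt (n := n) S F x)
    (L : EuclideanSpace ℝ (Fin n) →L[ℝ] EuclideanSpace ℝ (Fin N)) :
    (metricMatrix (n := n) S F x).det
        * LinearMap.trace ℝ _ ((tangentPart (n := n) S F x).comp L).toLinearMap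
      = ((metricMatrix (n := n) S F x).adjugate * Matrix.of fun i j =>
          S.form (L (EuclideanSpace.single i 1))
            (differential F x (EuclideanSpace.single j 1))).trace := by
  set C : Matrix (Fin n) (Fin n) ℝ := Matrix.of fun i j =>
    tangentPart (n := n) S F x (L (EuclideanSpace.single i 1)) j with hC
  -- With `G` the Gram matrix, `tr (adj G · C G) = tr (C · G adj G) = det G · tr C`, and `tr C` is
  -- the wanted trace.
  have hQ : (Matrix.of fun i j => S.form (L (EuclideanSpace.single i 1))
      (differential F x (EuclideanSpace.single j 1))) = C * metricMatrix (n := n) S F x := by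
    ext i j
    rw [Matrix.of_apply, ← h.metric_tangentPart, ← sum_smul_single (tangentPart S F x _)]
    simp [Matrix.mul_apply, hC, metricMatrix]
  rw [hQ, Matrix.trace_mul_comm, Matrix.mul_assoc, Matrix.mul_adjugate, trace_eq_sum_single]
  simp [Matrix.trace, hC, Finset.mul_sum]

/-- The Cauchy-Schwarz inequality between a covector and a vector. -/
theorem IsSpacelikeAt.apply_sq_le (h : IsSpacelikeAt (n := n) S F x)
    (hS : ∀ a b, S.form a b = S.form b a) (a : EuclideanSpace ℝ (Fin n) →L[ℝ] ℝ)
    (v : EuclideanSpace ℝ (Fin n)) : a v ^ 2 ≤ metric S F x v v * a (sharp S F x a) := by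
  have hnn : ∀ z, 0 ≤ metric (n := n) S F x z z := by
    intro z
    rcases eq_or_ne z 0 with rfl | hz
    · rw [map_zero]
    · exact (h z hz).le
  have hsym : ∀ z z', metric (n := n) S F x z z' = metric S F x z' z := fun z z' => hS _ _
  have := bilin_sq_le (metric (n := n) S F x) hsym hnn v (sharp S F x a)
  rwa [h.metric_sharp a] at this

end PointwiseGeometry


/-! ### Smoothness in coordinates, the divergence formula and Green's identity. -/

section CoordinateGeometry

variable {n N : ℕ} {S : ModelSpace N}
  {φ : EuclideanSpace ℝ (Fin n) → EuclideanSpace ℝ (Fin N)} {O : Set (EuclideanSpace ℝ (Fin n))}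

theorem differential_eq_fderiv (Y : EuclideanSpace ℝ (Fin n) → EuclideanSpace ℝ (Fin N))
    (y : EuclideanSpace ℝ (Fin n)) : differential Y y = fderiv ℝ Y y :=
  mfderiv_eq_fderiv

theorem differentialReal_eq_fderiv (u : EuclideanSpace ℝ (Fin n) → ℝ)
    (y : EuclideanSpace ℝ (Fin n)) : differentialReal u y = fderiv ℝ u y :=
  mfderiv_eq_fderiv

theorem contDiffOn_differential (hO : IsOpen O) (hφ : ContDiffOn ℝ ∞ φ O) :
    ContDiffOn ℝ ∞ (fun y => differential (n := n) φ y) O := by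
  simp_rw [differential_eq_fderiv]
  exact hφ.fderiv_of_isOpen hO (by simp)

theorem contDiffOn_metric (hO : IsOpen O) (hφ : ContDiffOn ℝ ∞ φ O) :
    ContDiffOn ℝ ∞ (fun y => metric (n := n) S φ y) O := by
  have hd := contDiffOn_differential hO hφ
  rw [contDiffOn_clm_apply]
  intro v
  rw [contDiffOn_clm_apply]
  intro w
  simp_rw [metric_apply]
  exact (S.form.contDiff.comp_contDiffOn (hd.clm_apply contDiffOn_const)).clm_apply
    (hd.clm_apply contDiffOn_const)

/-- Inversion of continuous linear maps is smooth at invertible ones. -/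
theorem contDiffOn_sharp (hO : IsOpen O) (hφ : ContDiffOn ℝ ∞ φ O)
    (h : ∀ y ∈ O, IsSpacelikeAt (n := n) S φ y) :
    ContDiffOn ℝ ∞ (fun y => sharp (n := n) S φ y) O := by
  intro y hy
  obtain ⟨A, hA⟩ := (h y hy).metric_isInvertible
  have hinv : ContDiffAt ℝ ∞ ContinuousLinearMap.inverse (metric (n := n) S φ y) := by
    rw [← hA]
    exact contDiffAt_map_inverse A
  exact hinv.comp_contDiffWithinAt y (contDiffOn_metric hO hφ y hy)

theorem contDiffOn_tangentPart (hO : IsOpen O) (hφ : ContDiffOn ℝ ∞ φ O)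
    (h : ∀ y ∈ O, IsSpacelikeAt (n := n) S φ y) :
    ContDiffOn ℝ ∞ (fun y => tangentPart (n := n) S φ y) O := by
  rw [contDiffOn_clm_apply]
  intro w
  simp_rw [tangentPart_apply]
  exact (contDiffOn_sharp hO hφ h).clm_apply
    (contDiffOn_const.clm_comp (contDiffOn_differential hO hφ))

theorem contDiffOn_gradient (hO : IsOpen O) (hφ : ContDiffOn ℝ ∞ φ O)
    (h : ∀ y ∈ O, IsSpacelikeAt (n := n) S φ y) {u : EuclideanSpace ℝ (Fin n) → ℝ}
    (hu : ContDiffOn ℝ ∞ u O) : ContDiffOn ℝ ∞ (gradient (n := n) S φ u) O := by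
  have hdu : ContDiffOn ℝ ∞ (fun y => differentialReal (n := n) u y) O := by
    simp_rw [differentialReal_eq_fderiv]
    exact hu.fderiv_of_isOpen hO (by simp)
  exact (contDiffOn_differential hO hφ).clm_apply ((contDiffOn_sharp hO hφ h).clm_apply hdu)

theorem contDiffOn_covariantDeriv (hO : IsOpen O) (hφ : ContDiffOn ℝ ∞ φ O)
    (h : ∀ y ∈ O, IsSpacelikeAt (n := n) S φ y)
    {Y : EuclideanSpace ℝ (Fin n) → EuclideanSpace ℝ (Fin N)} (hY : ContDiffOn ℝ ∞ Y O) :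
    ContDiffOn ℝ ∞ (fun y => covariantDeriv (n := n) S φ Y y) O :=
  (contDiffOn_tangentPart hO hφ h).clm_comp (contDiffOn_differential hO hY)

theorem contDiffOn_trace
    {A : EuclideanSpace ℝ (Fin n) → EuclideanSpace ℝ (Fin n) →L[ℝ] EuclideanSpace ℝ (Fin n)}
    (hA : ContDiffOn ℝ ∞ A O) :
    ContDiffOn ℝ ∞ (fun y => LinearMap.trace ℝ _ (A y).toLinearMap) O := by
  simp_rw [trace_eq_sum_single]
  refine ContDiffOn.sum fun i _ => ?_
  exact (contDiffOn_piLp 2).1 (hA.clm_apply contDiffOn_const) i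

theorem contDiffOn_laplacian (hO : IsOpen O) (hφ : ContDiffOn ℝ ∞ φ O)
    (h : ∀ y ∈ O, IsSpacelikeAt (n := n) S φ y) {u : EuclideanSpace ℝ (Fin n) → ℝ}
    (hu : ContDiffOn ℝ ∞ u O) : ContDiffOn ℝ ∞ (laplacian (n := n) S φ u) O :=
  contDiffOn_trace (contDiffOn_covariantDeriv hO hφ h (contDiffOn_gradient hO hφ h hu))

/-- The density `√(det g_{ij})` of the Riemannian measure in coordinates. -/
noncomputable def volumeDensity (S : ModelSpace N)
    (φ : EuclideanSpace ℝ (Fin n) → EuclideanSpace ℝ (Fin N)) (y : EuclideanSpace ℝ (Fin n)) : ℝ :=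
  √(metricMatrix (n := n) S φ y).det

theorem IsSpacelikeAt.volumeDensity_pos {y : EuclideanSpace ℝ (Fin n)}
    (h : IsSpacelikeAt (n := n) S φ y) (hS : ∀ a b, S.form a b = S.form b a) :
    0 < volumeDensity S φ y :=
  Real.sqrt_pos.2 (h.posDef_metricMatrix hS).det_pos

theorem contDiffOn_volumeDensity (hO : IsOpen O) (hφ : ContDiffOn ℝ ∞ φ O)
    (h : ∀ y ∈ O, IsSpacelikeAt (n := n) S φ y) (hS : ∀ a b, S.form a b = S.form b a) :
    ContDiffOn ℝ ∞ (volumeDensity (n := n) S φ) O := by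
  refine ContDiffOn.sqrt ?_ fun y hy => ((h y hy).posDef_metricMatrix hS).det_pos.ne'
  simp_rw [Matrix.det_apply']
  refine ContDiffOn.sum fun σ _ => contDiffOn_const.mul (contDiffOn_prod fun i _ => ?_)
  exact ((contDiffOn_metric hO hφ).clm_apply contDiffOn_const).clm_apply contDiffOn_const

theorem hasDerivAt_along_line {G : Type*} [NormedAddCommGroup G] [NormedSpace ℝ G]
    {g : EuclideanSpace ℝ (Fin n) → G} {y : EuclideanSpace ℝ (Fin n)}
    (hg : DifferentiableAt ℝ g y) (ξ : EuclideanSpace ℝ (Fin n)) :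
    HasDerivAt (fun t : ℝ => g (y + t • ξ)) (fderiv ℝ g y ξ) 0 :=
  hg.hasFDerivAt.hasLineDerivAt ξ

/-- The logarithmic derivative of the volume density. -/
theorem fderiv_volumeDensity (hO : IsOpen O) (hφ : ContDiffOn ℝ ∞ φ O)
    (h : ∀ y ∈ O, IsSpacelikeAt (n := n) S φ y) (hS : ∀ a b, S.form a b = S.form b a)
    {y : EuclideanSpace ℝ (Fin n)} (hy : y ∈ O) (ξ : EuclideanSpace ℝ (Fin n)) :
    fderiv ℝ (volumeDensity S φ) y ξ = volumeDensity S φ y *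
      LinearMap.trace ℝ _ ((tangentPart (n := n) S φ y).comp
        (fderiv ℝ (fderiv ℝ φ) y ξ)).toLinearMap := by
  set L := fderiv ℝ (fderiv ℝ φ) y ξ with hL
  set Q : Matrix (Fin n) (Fin n) ℝ := Matrix.of fun i j =>
    S.form (L (EuclideanSpace.single i 1)) (differential φ y (EuclideanSpace.single j 1)) with hQ
  have hpos := (h y hy).posDef_metricMatrix hS |>.det_pos
  have hdφ : DifferentiableAt ℝ (fderiv ℝ φ) y :=
    ((hφ.fderiv_of_isOpen hO (m := ∞) (by simp)).contDiffAt (hO.mem_nhds hy)).differentiableAt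
      (by simp)
  have hline := hasDerivAt_along_line hdφ ξ
  have hentry : ∀ i j, HasDerivAt (fun t : ℝ => metricMatrix (n := n) S φ (y + t • ξ) i j)
      ((Q + Q.transpose) i j) 0 := by
    intro i j
    have h1 := hline.clm_apply (hasDerivAt_const (0 : ℝ) (EuclideanSpace.single i (1 : ℝ)))
    have h2 := hline.clm_apply (hasDerivAt_const (0 : ℝ) (EuclideanSpace.single j (1 : ℝ)))
    have h3 := (S.form.hasFDerivAt.comp_hasDerivAt (0 : ℝ) h1).clm_apply h2
    have hf : (fun t : ℝ => metricMatrix (n := n) S φ (y + t • ξ) i j) = fun t : ℝ =>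
        S.form (fderiv ℝ φ (y + t • ξ) (EuclideanSpace.single i 1))
          (fderiv ℝ φ (y + t • ξ) (EuclideanSpace.single j 1)) := by
      funext t
      simp [metricMatrix, metric_apply, differential_eq_fderiv]
    rw [hf]
    refine h3.congr_deriv ?_
    simp only [zero_smul, add_zero, map_zero, Function.comp_apply, Matrix.add_apply, hQ,
      Matrix.of_apply, Matrix.transpose_apply, differential_eq_fderiv, ← hL]
    rw [hS (L (EuclideanSpace.single j 1))]
  have hdet := hasDerivAt_det hentry
  -- As the Gram matrix is symmetric, both halves of its derivative `Q + Qᵀ` contribute equally; the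
  -- resulting factor 2 cancels the one from differentiating the square root.
  have htr : ((metricMatrix (n := n) S φ y).adjugate * Q.transpose).trace
      = ((metricMatrix (n := n) S φ y).adjugate * Q).trace := by
    rw [← Matrix.trace_transpose, Matrix.transpose_mul, Matrix.transpose_transpose,
      Matrix.trace_mul_comm, Matrix.adjugate_transpose, metricMatrix_transpose hS]
  simp only [zero_smul, add_zero] at hdet
  rw [Matrix.mul_add, Matrix.trace_add, htr, ← (h y hy).det_mul_trace_tangentPart_comp] at hdet
  have hsqrt := hdet.sqrt (by simpa using hpos.ne')
  have hρ : DifferentiableAt ℝ (volumeDensity (n := n) S φ) y :=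
    ((contDiffOn_volumeDensity hO hφ h hS).contDiffAt (hO.mem_nhds hy)).differentiableAt (by simp)
  rw [(hasDerivAt_along_line hρ ξ).unique hsqrt]
  have hs : √(metricMatrix (n := n) S φ y).det ≠ 0 := (Real.sqrt_pos.2 hpos).ne'
  have hss := Real.mul_self_sqrt hpos.le
  simp only [zero_smul, add_zero]
  rw [volumeDensity, div_eq_iff (by positivity)]
  linear_combination (-2 * LinearMap.trace ℝ _ ((tangentPart (n := n) S φ y).comp L).toLinearMap)
    * hss

/-- The divergence of a tangential field in coordinates. -/
theorem volumeDensity_mul_trace_covariantDeriv (hO : IsOpen O) (hφ : ContDiffOn ℝ ∞ φ O)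
    (h : ∀ y ∈ O, IsSpacelikeAt (n := n) S φ y) (hS : ∀ a b, S.form a b = S.form b a)
    {ξ : EuclideanSpace ℝ (Fin n) → EuclideanSpace ℝ (Fin n)} (hξ : ContDiffOn ℝ ∞ ξ O)
    {y : EuclideanSpace ℝ (Fin n)} (hy : y ∈ O) :
    volumeDensity S φ y * LinearMap.trace ℝ _
        (covariantDeriv (n := n) S φ (fun z => differential φ z (ξ z)) y).toLinearMap
      = LinearMap.trace ℝ _ (fderiv ℝ (fun z => volumeDensity S φ z • ξ z) y).toLinearMap := by
  have hdφ : DifferentiableAt ℝ (fderiv ℝ φ) y :=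
    ((hφ.fderiv_of_isOpen hO (m := ∞) (by simp)).contDiffAt (hO.mem_nhds hy)).differentiableAt
      (by simp)
  have hdξ : DifferentiableAt ℝ ξ y :=
    (hξ.contDiffAt (hO.mem_nhds hy)).differentiableAt (by simp)
  have hρ : DifferentiableAt ℝ (volumeDensity (n := n) S φ) y :=
    ((contDiffOn_volumeDensity hO hφ h hS).contDiffAt (hO.mem_nhds hy)).differentiableAt (by simp)
  have hsymm : ∀ v w, fderiv ℝ (fderiv ℝ φ) y v w = fderiv ℝ (fderiv ℝ φ) y w v :=
    (hφ.contDiffAt (hO.mem_nhds hy)).isSymmSndFDerivAt (by simpa using ENat.LEInfty.out)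
  -- Product rule for `dφ(ξ)`. Symmetry of `D²φ` puts `ξ` in the first slot, so the trace of the
  -- second term is the logarithmic derivative of the density along `ξ`.
  have h1 : covariantDeriv (n := n) S φ (fun z => differential φ z (ξ z)) y
      = fderiv ℝ ξ y + (tangentPart (n := n) S φ y).comp (fderiv ℝ (fderiv ℝ φ) y (ξ y)) := by
    ext1 v
    have e : fderiv ℝ (fun z => fderiv ℝ φ z (ξ z)) y v
        = fderiv ℝ φ y (fderiv ℝ ξ y v) + fderiv ℝ (fderiv ℝ φ) y (ξ y) v := by
      rw [(hdφ.hasFDerivAt.clm_apply hdξ.hasFDerivAt).fderiv]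
      simp [hsymm v]
    have e' : covariantDeriv (n := n) S φ (fun z => differential φ z (ξ z)) y v
        = tangentPart (n := n) S φ y (fderiv ℝ (fun z => fderiv ℝ φ z (ξ z)) y v) := by
      rw [← differential_eq_fderiv]
      simp_rw [← differential_eq_fderiv]
      rfl
    rw [e', e, map_add, ← differential_eq_fderiv, (h y hy).tangentPart_differential]
    rfl
  have h2 : fderiv ℝ (fun z => volumeDensity S φ z • ξ z) y = volumeDensity S φ y • fderiv ℝ ξ y
      + (fderiv ℝ (volumeDensity S φ) y).smulRight (ξ y) :=
    (hρ.hasFDerivAt.smul hdξ.hasFDerivAt).fderiv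
  have h3 : LinearMap.trace ℝ _ ((fderiv ℝ (volumeDensity S φ) y).smulRight (ξ y)).toLinearMap
      = fderiv ℝ (volumeDensity S φ) y (ξ y) := by
    rw [trace_eq_sum_single]
    conv_rhs => rw [← sum_smul_single (ξ y)]
    simp [map_sum, mul_comm]
  rw [h1, h2, ContinuousLinearMap.toLinearMap_add, ContinuousLinearMap.toLinearMap_add, map_add,
    map_add, h3, fderiv_volumeDensity hO hφ h hS hy, ContinuousLinearMap.toLinearMap_smul, map_smul,
    smul_eq_mul, mul_add]

/-- Green's identity in coordinates. -/
theorem integral_mul_laplacian_mul_volumeDensity (hO : IsOpen O) (hφ : ContDiffOn ℝ ∞ φ O)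
    (h : ∀ y ∈ O, IsSpacelikeAt (n := n) S φ y) (hS : ∀ a b, S.form a b = S.form b a)
    {u : EuclideanSpace ℝ (Fin n) → ℝ} (hu : ContDiff ℝ ∞ u) (hc : HasCompactSupport u)
    (hs : tsupport u ⊆ O) :
    ∫ y, u y * (laplacian (n := n) S φ u y * volumeDensity S φ y)
      = -∫ y, fderiv ℝ u y (sharp (n := n) S φ y (fderiv ℝ u y)) * volumeDensity S φ y := by
  have hξ : ContDiffOn ℝ ∞ (fun y => sharp (n := n) S φ y (fderiv ℝ u y)) O :=
    (contDiffOn_sharp hO hφ h).clm_apply (hu.contDiffOn.fderiv_of_isOpen hO (by simp))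
  have hX := (contDiffOn_volumeDensity hO hφ h hS).smul hξ
  have key := integral_mul_trace_fderiv hO hu hc hs hX
  have e1 : ∀ y, u y * (laplacian (n := n) S φ u y * volumeDensity S φ y) = u y * LinearMap.trace ℝ _
      (fderiv ℝ (fun z => volumeDensity S φ z • sharp (n := n) S φ z (fderiv ℝ u z)) y).toLinearMap := by
    intro y
    by_cases hy : u y = 0
    · simp [hy]
    · rw [← volumeDensity_mul_trace_covariantDeriv hO hφ h hS hξ (hs (subset_tsupport _ hy)),
        mul_comm (laplacian (n := n) S φ u y)]
      simp_rw [← differentialReal_eq_fderiv]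
      rfl
  simp_rw [e1]
  refine key.trans ?_
  refine congrArg Neg.neg (integral_congr_ae (ae_of_all _ fun y => ?_))
  refine (map_smul (fderiv ℝ u y) (volumeDensity S φ y) _).trans ?_
  exact mul_comm _ _

end CoordinateGeometry


/-! ### Positivity of the stability form on small coordinate balls. -/

section LocalStability

variable {n N : ℕ} {S : ModelSpace N}
  {φ : EuclideanSpace ℝ (Fin n) → EuclideanSpace ℝ (Fin N)} {O : Set (EuclideanSpace ℝ (Fin n))}

theorem integrable_of_continuousOn_of_eq_zero {X : Type*} [TopologicalSpace X] [R1Space X]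
    [MeasurableSpace X] [OpensMeasurableSpace X] {μ : Measure X} [IsFiniteMeasureOnCompacts μ]
    {O K : Set X} (hO : IsOpen O) (hK : IsCompact K) (hKc : IsClosed K) (hKO : K ⊆ O) {g : X → ℝ}
    (hg : ContinuousOn g O) (h0 : ∀ x, x ∉ K → g x = 0) : Integrable g μ := by
  have hs : tsupport g ⊆ K := closure_minimal (fun x hx => by
    by_contra hxK
    exact hx (h0 x hxK)) hKc
  refine Continuous.integrable_of_hasCompactSupport ?_ (HasCompactSupport.intro' hK hKc h0)
  exact continuous_of_tsupport fun x hx => hg.continuousAt (hO.mem_nhds (hKO (hs hx)))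

/-- The quadratic form of a Schrödinger operator `Δ + V` is negative definite on functions with
support in a small coordinate ball. -/
theorem exists_ball_integral_neg (hO : IsOpen O) (hφ : ContDiffOn ℝ ∞ φ O)
    (h : ∀ y ∈ O, IsSpacelikeAt (n := n) S φ y) (hS : ∀ a b, S.form a b = S.form b a)
    {V : EuclideanSpace ℝ (Fin n) → ℝ} (hV : ContinuousOn V O) (i : Fin n)
    {y₀ : EuclideanSpace ℝ (Fin n)} (hy₀ : y₀ ∈ O) :
    ∃ r > 0, Metric.ball y₀ r ⊆ O ∧ ∀ u : EuclideanSpace ℝ (Fin n) → ℝ, ContDiff ℝ ∞ u →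
      HasCompactSupport u → tsupport u ⊆ Metric.ball y₀ r → (∃ y, u y ≠ 0) →
      0 < -∫ y, u y * ((laplacian (n := n) S φ u y + V y * u y) * volumeDensity S φ y) := by
  set v : EuclideanSpace ℝ (Fin n) := EuclideanSpace.single i 1 with hv
  have hv0 : v ≠ 0 := by simp [hv]
  have hOn := hO.mem_nhds hy₀
  have hρ := (contDiffOn_volumeDensity hO hφ h hS).continuousOn
  have hG : ContinuousOn (fun y => metric (n := n) S φ y v v) O :=
    (((contDiffOn_metric hO hφ).clm_apply contDiffOn_const).clm_apply
      contDiffOn_const).continuousOn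
  -- Near `y₀`, `a` bounds `g(v, v)` from above, `c` bounds the density from below and `C > 0`
  -- bounds `V` times the density from above. Thus the energy density is at least `(c / a) (∂ᵥu)²`
  -- and the potential term at most `C u²`.
  obtain ⟨a, hGa⟩ := exists_gt (metric (n := n) S φ y₀ v v)
  obtain ⟨c, hc0, hcρ⟩ := exists_between ((h y₀ hy₀).volumeDensity_pos hS)
  obtain ⟨C, hC⟩ := exists_gt (max 0 (V y₀ * volumeDensity S φ y₀))
  have hC0 : 0 < C := (le_max_left _ _).trans_lt hC
  have ha0 : 0 < a := ((h y₀ hy₀) v hv0).trans hGa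
  have hev : ∀ᶠ y in 𝓝 y₀, y ∈ O ∧ metric (n := n) S φ y v v < a ∧ c < volumeDensity S φ y ∧
      V y * volumeDensity S φ y < C := by
    filter_upwards [hOn, (hG.continuousAt hOn).eventually_lt_const hGa,
      (hρ.continuousAt hOn).eventually_const_lt hcρ,
      ((hV.mul hρ).continuousAt hOn).eventually_lt_const ((le_max_right _ _).trans_lt hC)]
      with y h1 h2 h3 h4
    exact ⟨h1, h2, h3, h4⟩
  obtain ⟨ε, hε, hball⟩ := Metric.eventually_nhds_iff_ball.1 hev
  -- As `r ≤ 1`, one has `r² ≤ r ≤ δ`, so `4 r² C ≤ c / (2a) < c / a`: the Poincaré constant times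
  -- `C` stays strictly below the energy coefficient.
  set δ : ℝ := c / (8 * a * C) with hδ
  have hδ0 : 0 < δ := by positivity
  set r : ℝ := min ε (min 1 δ) with hr
  have hr0 : 0 < r := by positivity
  have hrε : Metric.ball y₀ r ⊆ Metric.ball y₀ ε := Metric.ball_subset_ball (min_le_left _ _)
  have hr2 : 4 * r ^ 2 * C < c / a := by
    have h1 : r ≤ 1 := (min_le_right _ _).trans (min_le_left _ _)
    have h2 : r ≤ δ := (min_le_right _ _).trans (min_le_right _ _)
    have h3 : r ^ 2 ≤ δ := by nlinarith
    have h4 : 4 * δ * C = c / a / 2 := by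
      rw [hδ]
      field_simp
      norm_num
    have h5 : 0 < c / a := by positivity
    have h6 : 4 * r ^ 2 * C ≤ 4 * δ * C := by gcongr
    linarith
  refine ⟨r, hr0, fun y hy => (hball y (hrε hy)).1, fun u hu hcu hsu hne => ?_⟩
  have hsO : tsupport u ⊆ O := fun y hy => (hball y (hrε (hsu hy))).1
  have hdu0 : ∀ y, y ∉ tsupport u → fderiv ℝ u y = 0 := fun y hy =>
    fderiv_of_notMem_tsupport ℝ hy
  have hu0 : ∀ y, y ∉ tsupport u → u y = 0 := fun y hy => image_eq_zero_of_notMem_tsupport hy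
  have hduO : ContDiffOn ℝ ∞ (fderiv ℝ u) O := hu.contDiffOn.fderiv_of_isOpen hO (by simp)
  have hiE : Integrable fun y =>
      fderiv ℝ u y (sharp (n := n) S φ y (fderiv ℝ u y)) * volumeDensity S φ y := by
    refine integrable_of_continuousOn_of_eq_zero hO hcu (isClosed_tsupport u) hsO
      (ContinuousOn.mul ?_ hρ) fun y hy => by simp [hdu0 y hy]
    exact (hduO.clm_apply ((contDiffOn_sharp hO hφ h).clm_apply hduO)).continuousOn
  have hiV : Integrable fun y => u y * (V y * u y * volumeDensity S φ y) :=
    integrable_mul_of_tsupport_subset hO hu.continuous hcu hsO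
      ((hV.mul hu.continuous.continuousOn).mul hρ)
  have hiL : Integrable fun y => u y * (laplacian (n := n) S φ u y * volumeDensity S φ y) :=
    integrable_mul_of_tsupport_subset hO hu.continuous hcu hsO
      ((contDiffOn_laplacian hO hφ h hu.contDiffOn).continuousOn.mul hρ)
  have hsplit : -∫ y, u y * ((laplacian (n := n) S φ u y + V y * u y) * volumeDensity S φ y)
      = ∫ y, (fderiv ℝ u y (sharp (n := n) S φ y (fderiv ℝ u y)) * volumeDensity S φ y
          - u y * (V y * u y * volumeDensity S φ y)) := by
    simp_rw [add_mul, mul_add]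
    rw [integral_add hiL hiV, integral_sub hiE hiV,
      integral_mul_laplacian_mul_volumeDensity hO hφ h hS hu hcu hsO]
    ring
  have hdv : Continuous fun y => fderiv ℝ u y v :=
    (hu.continuous_fderiv (by simp)).clm_apply continuous_const
  have hdvc : HasCompactSupport fun y => fderiv ℝ u y v :=
    hcu.of_isClosed_subset (isClosed_tsupport _) (tsupport_fderiv_apply_subset ℝ v)
  have hi1 : Integrable fun y => fderiv ℝ u y v ^ 2 := hdv.integrable_sq_of_hasCompactSupport hdvc
  have hi2 : Integrable fun y => u y ^ 2 := hu.continuous.integrable_sq_of_hasCompactSupport hcu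
  have hlow : ∫ y, (c / a * fderiv ℝ u y v ^ 2 - C * u y ^ 2)
      ≤ ∫ y, (fderiv ℝ u y (sharp (n := n) S φ y (fderiv ℝ u y)) * volumeDensity S φ y
          - u y * (V y * u y * volumeDensity S φ y)) := by
    refine integral_mono ((hi1.const_mul _).sub (hi2.const_mul _)) (hiE.sub hiV) fun y => ?_
    by_cases hy : y ∈ tsupport u
    · obtain ⟨hyO, hyG, hyρ, hyV⟩ := hball y (hrε (hsu hy))
      have hcs := (h y hyO).apply_sq_le hS (fderiv ℝ u y) v
      have hG0 := h y hyO v hv0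
      rw [← metric_apply] at hG0
      dsimp only
      generalize fderiv ℝ u y (sharp (n := n) S φ y (fderiv ℝ u y)) = q at hcs ⊢
      generalize metric (n := n) S φ y v v = G at *
      have hq : 0 ≤ q := by
        by_contra hneg
        nlinarith [sq_nonneg (fderiv ℝ u y v)]
      have h1 : fderiv ℝ u y v ^ 2 / a ≤ q := by
        rw [div_le_iff₀ ha0]
        nlinarith
      have h2 : c / a * fderiv ℝ u y v ^ 2 ≤ q * volumeDensity S φ y := by
        calc c / a * fderiv ℝ u y v ^ 2 = fderiv ℝ u y v ^ 2 / a * c := by ring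
          _ ≤ q * volumeDensity S φ y := mul_le_mul h1 hyρ.le hc0.le hq
      have h3 : V y * volumeDensity S φ y * u y ^ 2 ≤ C * u y ^ 2 := by gcongr
      linarith
    · simp [hdu0 y hy, hu0 y hy]
  have hposu : 0 < ∫ y, u y ^ 2 := by
    obtain ⟨y, hy⟩ := hne
    exact (hu.continuous.pow 2).integral_pos_of_hasCompactSupport_nonneg_nonzero hcu.sq
      (fun y => sq_nonneg _) (x := y) (by simpa using hy)
  have hpoin := integral_sq_le_integral_fderiv_sq i hu hcu hsu
  rw [← hv] at hpoin
  rw [hsplit]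
  refine lt_of_lt_of_le ?_ hlow
  rw [integral_sub (hi1.const_mul _) (hi2.const_mul _), integral_const_mul, integral_const_mul]
  -- Poincaré's inequality excludes zero energy for `u ≠ 0`, which makes the final comparison
  -- strict.
  have hposd : 0 < ∫ y, fderiv ℝ u y v ^ 2 := by
    by_contra hneg
    have : 4 * r ^ 2 * ∫ y, fderiv ℝ u y v ^ 2 ≤ 0 :=
      mul_nonpos_of_nonneg_of_nonpos (by positivity) (not_lt.1 hneg)
    linarith
  have h1 := mul_le_mul_of_nonneg_left hpoin hC0.le
  have h2 := mul_lt_mul_of_pos_right hr2 hposd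
  linarith

end LocalStability


/-! ### Independence of the geometric quantities from the chart. -/

section Charts

variable {n N : ℕ} {M : Type*} [TopologicalSpace M]
  [ChartedSpace (EuclideanSpace ℝ (Fin n)) M] {S : ModelSpace N} {F : M → EuclideanSpace ℝ (Fin N)}
  {e : OpenPartialHomeomorph M (EuclideanSpace ℝ (Fin n))} {x : M}

theorem contDiffOn_comp_symm {G : Type*} [NormedAddCommGroup G] [NormedSpace ℝ G] {Y : M → G}
    (hY : ContMDiff (𝓡 n) 𝓘(ℝ, G) ∞ Y) (he : e ∈ IsManifold.maximalAtlas (𝓡 n) ∞ M) :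
    ContDiffOn ℝ ∞ (Y ∘ e.symm) e.target :=
  (hY.comp_contMDiffOn (contMDiffOn_symm_of_mem_maximalAtlas he)).contDiffOn

/-- The derivative at `x` of a chart, through which all differentials of maps factor. -/
theorem exists_chart_deriv [IsManifold (𝓡 n) ∞ M]
    (he : e ∈ IsManifold.maximalAtlas (𝓡 n) ∞ M) (hx : x ∈ e.source) :
    ∃ L : EuclideanSpace ℝ (Fin n) ≃L[ℝ] EuclideanSpace ℝ (Fin n),
      (∀ (Y : M → EuclideanSpace ℝ (Fin N)) (Z : EuclideanSpace ℝ (Fin n) →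
        EuclideanSpace ℝ (Fin N)), Y =ᶠ[𝓝 x] Z ∘ e → DifferentiableAt ℝ Z (e x) →
        ∀ v, differential Y x v = differential Z (e x) (L v)) ∧
      (∀ (f : M → ℝ) (u : EuclideanSpace ℝ (Fin n) → ℝ), f =ᶠ[𝓝 x] u ∘ e →
        DifferentiableAt ℝ u (e x) →
        ∀ v, differentialReal f x v = differentialReal u (e x) (L v)) := by
  have hemd : e.MDifferentiable (𝓡 n) (𝓡 n) :=
    ⟨(contMDiffOn_of_mem_maximalAtlas he).mdifferentiableOn (by simp),
      (contMDiffOn_symm_of_mem_maximalAtlas he).mdifferentiableOn (by simp)⟩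
  refine ⟨hemd.mfderiv hx, fun Y Z hYZ hZ v => ?_, fun f u hfu hu v => ?_⟩
  · rw [differential, hYZ.mfderiv_eq,
      mfderiv_comp x hZ.mdifferentiableAt (hemd.mdifferentiableAt hx)]
    rfl
  · rw [differentialReal, hfu.mfderiv_eq,
      mfderiv_comp x hu.mdifferentiableAt (hemd.mdifferentiableAt hx)]
    rfl

theorem eventuallyEq_comp_symm_comp {M H G : Type*} [TopologicalSpace M] [TopologicalSpace H]
    {e : OpenPartialHomeomorph M H} {x : M} (Y : M → G) (hx : x ∈ e.source) : Y =ᶠ[𝓝 x] (Y ∘ e.symm) ∘ e := by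
  filter_upwards [e.eventually_left_inverse hx] with z hz
  simp [hz]

theorem differentiableAt_comp_symm {G : Type*} [NormedAddCommGroup G] [NormedSpace ℝ G] {Y : M → G}
    (hY : ContMDiff (𝓡 n) 𝓘(ℝ, G) ∞ Y) (he : e ∈ IsManifold.maximalAtlas (𝓡 n) ∞ M)
    (hx : x ∈ e.source) : DifferentiableAt ℝ (Y ∘ e.symm) (e x) :=
  ((contDiffOn_comp_symm hY he).contDiffAt
    (e.open_target.mem_nhds (e.map_source hx))).differentiableAt (by simp)

theorem IsSpacelikeAt.comp_symm [IsManifold (𝓡 n) ∞ M]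
    (h : IsSpacelikeAt (n := n) S F x)
    (hF : ContMDiff (𝓡 n) 𝓘(ℝ, EuclideanSpace ℝ (Fin N)) ∞ F)
    (he : e ∈ IsManifold.maximalAtlas (𝓡 n) ∞ M) (hx : x ∈ e.source) :
    IsSpacelikeAt (n := n) S (F ∘ e.symm) (e x) := by
  obtain ⟨L, hL, -⟩ := exists_chart_deriv (N := N) he hx
  intro v hv
  have := h (L.symm v) (by simpa using hv)
  rw [hL F _ (eventuallyEq_comp_symm_comp F hx) (differentiableAt_comp_symm hF he hx)] at this
  simpa using this

theorem isSpacelikeAt_comp_symm_of_mem_target [IsManifold (𝓡 n) ∞ M]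
    (h : ∀ x, IsSpacelikeAt (n := n) S F x)
    (hF : ContMDiff (𝓡 n) 𝓘(ℝ, EuclideanSpace ℝ (Fin N)) ∞ F)
    (he : e ∈ IsManifold.maximalAtlas (𝓡 n) ∞ M) :
    ∀ y ∈ e.target, IsSpacelikeAt (n := n) S (F ∘ e.symm) y := fun y hy => by
  simpa [hy] using (h (e.symm y)).comp_symm hF he (e.map_target hy)

section Naturality

variable {L : EuclideanSpace ℝ (Fin n) ≃L[ℝ] EuclideanSpace ℝ (Fin n)}

theorem sharp_chart (h : IsSpacelikeAt (n := n) S F x)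
    (hφ : IsSpacelikeAt (n := n) S (F ∘ e.symm) (e x))
    (hL : ∀ v, differential F x v = differential (F ∘ e.symm) (e x) (L v))
    (a : EuclideanSpace ℝ (Fin n) →L[ℝ] ℝ) :
    sharp S F x a = L.symm (sharp S (F ∘ e.symm) (e x) (a.comp
      (L.symm : EuclideanSpace ℝ (Fin n) →L[ℝ] EuclideanSpace ℝ (Fin n)))) := by
  rw [← h.sharp_metric (L.symm _)]
  congr 1
  ext w
  rw [metric_apply, hL, hL, L.apply_symm_apply, ← metric_apply, hφ.metric_sharp]
  simp

theorem tangentPart_chart (h : IsSpacelikeAt (n := n) S F x)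
    (hφ : IsSpacelikeAt (n := n) S (F ∘ e.symm) (e x))
    (hL : ∀ v, differential F x v = differential (F ∘ e.symm) (e x) (L v))
    (w : EuclideanSpace ℝ (Fin N)) :
    tangentPart (n := n) S F x w = L.symm (tangentPart (n := n) S (F ∘ e.symm) (e x) w) := by
  rw [tangentPart_apply, tangentPart_apply, sharp_chart h hφ hL]
  congr 2
  ext v
  simp [hL]

/-- Covariant derivatives and Weingarten maps in different charts are conjugate by the chart's
derivative, so their traces agree. -/
theorem trace_conj_chart {A B : EuclideanSpace ℝ (Fin n) →L[ℝ] EuclideanSpace ℝ (Fin n)}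
    (hAB : ∀ v, A v = L.symm (B (L v))) :
    LinearMap.trace ℝ _ A.toLinearMap = LinearMap.trace ℝ _ B.toLinearMap := by
  rw [← LinearMap.trace_conj' B.toLinearMap L.symm.toLinearEquiv]
  congr 1
  ext1 v
  exact hAB v

end Naturality

variable [IsManifold (𝓡 n) ∞ M]

/-- The gradient takes values in `ℝᴺ`: the chart derivative in `dF` cancels its inverse in `sharp`.
-/
theorem gradient_chart (h : IsSpacelikeAt (n := n) S F x)
    (hF : ContMDiff (𝓡 n) 𝓘(ℝ, EuclideanSpace ℝ (Fin N)) ∞ F)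
    (he : e ∈ IsManifold.maximalAtlas (𝓡 n) ∞ M) (hx : x ∈ e.source) {f : M → ℝ}
    {u : EuclideanSpace ℝ (Fin n) → ℝ} (hu : DifferentiableAt ℝ u (e x))
    (hfu : ∀ z ∈ e.source, f z = u (e z)) :
    gradient (n := n) S F f x = gradient (n := n) S (F ∘ e.symm) u (e x) := by
  obtain ⟨L, hL, hLr⟩ := exists_chart_deriv (N := N) he hx
  have hLF := hL F _ (eventuallyEq_comp_symm_comp F hx) (differentiableAt_comp_symm hF he hx)
  have hLf := hLr f u (Filter.eventually_of_mem (e.open_source.mem_nhds hx) hfu) hu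
  rw [gradient, gradient, hLF, sharp_chart h (h.comp_symm hF he hx) hLF, L.apply_symm_apply]
  congr 2
  ext v
  simp [hLf]

theorem laplacian_chart (h : ∀ z, IsSpacelikeAt (n := n) S F z)
    (hF : ContMDiff (𝓡 n) 𝓘(ℝ, EuclideanSpace ℝ (Fin N)) ∞ F)
    (he : e ∈ IsManifold.maximalAtlas (𝓡 n) ∞ M) (hx : x ∈ e.source) {f : M → ℝ}
    {u : EuclideanSpace ℝ (Fin n) → ℝ} (hu : ContDiff ℝ ∞ u)
    (hfu : ∀ z ∈ e.source, f z = u (e z)) :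
    laplacian (n := n) S F f x = laplacian (n := n) S (F ∘ e.symm) u (e x) := by
  obtain ⟨L, hL, -⟩ := exists_chart_deriv (N := N) he hx
  have hLF := hL F _ (eventuallyEq_comp_symm_comp F hx) (differentiableAt_comp_symm hF he hx)
  -- The gradient is differentiated once more, so equality is needed on a neighbourhood and not only
  -- at `x`.
  have hgrad : gradient (n := n) S F f =ᶠ[𝓝 x] gradient (n := n) S (F ∘ e.symm) u ∘ e := by
    filter_upwards [e.open_source.mem_nhds hx] with z hz
    exact gradient_chart (h z) hF he hz (hu.differentiable (by simp) _) hfu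
  have hdiff : DifferentiableAt ℝ (gradient (n := n) S (F ∘ e.symm) u) (e x) :=
    ((contDiffOn_gradient e.open_target (contDiffOn_comp_symm hF he)
      (isSpacelikeAt_comp_symm_of_mem_target h hF he) hu.contDiffOn).contDiffAt
        (e.open_target.mem_nhds (e.map_source hx))).differentiableAt (by simp)
  refine trace_conj_chart (L := L) fun v => ?_
  have := hL _ _ hgrad hdiff v
  simp only [covariantDeriv, ContinuousLinearMap.comp_apply]
  rw [this, tangentPart_chart (h x) ((h x).comp_symm hF he hx) hLF]

theorem trace_weingarten_sq_chart {ν : M → EuclideanSpace ℝ (Fin N)}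
    (h : IsSpacelikeAt (n := n) S F x)
    (hF : ContMDiff (𝓡 n) 𝓘(ℝ, EuclideanSpace ℝ (Fin N)) ∞ F)
    (hν : ContMDiff (𝓡 n) 𝓘(ℝ, EuclideanSpace ℝ (Fin N)) ∞ ν)
    (he : e ∈ IsManifold.maximalAtlas (𝓡 n) ∞ M) (hx : x ∈ e.source) :
    LinearMap.trace ℝ _
        ((weingarten (n := n) S F ν x).comp (weingarten (n := n) S F ν x)).toLinearMap
      = LinearMap.trace ℝ _ ((weingarten (n := n) S (F ∘ e.symm) (ν ∘ e.symm) (e x)).comp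
        (weingarten (n := n) S (F ∘ e.symm) (ν ∘ e.symm) (e x))).toLinearMap := by
  obtain ⟨L, hL, -⟩ := exists_chart_deriv (N := N) he hx
  have hLF := hL F _ (eventuallyEq_comp_symm_comp F hx) (differentiableAt_comp_symm hF he hx)
  have hLν := hL ν _ (eventuallyEq_comp_symm_comp ν hx) (differentiableAt_comp_symm hν he hx)
  have hw : ∀ v, weingarten (n := n) S F ν x v
      = L.symm (weingarten (n := n) S (F ∘ e.symm) (ν ∘ e.symm) (e x) (L v)) := by
    intro v
    simp only [weingarten, FunLike.coe_neg, Pi.neg_apply, ContinuousLinearMap.comp_apply, map_neg]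
    rw [hLν, tangentPart_chart h (h.comp_symm hF he hx) hLF]
  refine trace_conj_chart (L := L) fun v => ?_
  simp only [ContinuousLinearMap.comp_apply]
  rw [hw, hw, L.apply_symm_apply]

end Charts


/-! ### Gluing measures that agree on overlaps. -/

section MeasureLemmas

theorem measurableSet_preimage_inter {X Y : Type*} [TopologicalSpace X] [MeasurableSpace X]
    [OpensMeasurableSpace X] [TopologicalSpace Y] [MeasurableSpace Y] [BorelSpace Y]
    {g : X → Y} {s : Set X} (hg : ContinuousOn g s) (hs : MeasurableSet s) {A : Set Y}
    (hA : MeasurableSet A) : MeasurableSet (g ⁻¹' A ∩ s) := by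
  have h := (continuousOn_iff_continuous_domRestrict.1 hg).measurable hA
  have := hs.subtype_image h
  convert this using 1
  ext x
  simp [and_comm]

/-- A supremum of measures that agree pairwise on the overlaps of the sets carrying them restricts
to each of them. -/
theorem restrict_biSup_eq {X ι : Type*} [MeasurableSpace X] {p : ι → Prop} {m : ι → Measure X}
    {s : ι → Set X} (hs : ∀ i, MeasurableSet (s i)) (hm : ∀ i, p i → m i (s i)ᶜ = 0)
    (hag : ∀ i j, p i → p j → ∀ A, MeasurableSet A → A ⊆ s i → A ⊆ s j → m i A = m j A)
    {i : ι} (hi : p i) : (⨆ j, ⨆ _ : p j, m j).restrict (s i) = m i := by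
  set μ := ⨆ j, ⨆ _ : p j, m j with hμ
  have hle : ∀ j, p j → m j ≤ μ := fun j hj => le_iSup₂ (f := fun j (_ : p j) => m j) j hj
  -- This right-hand side dominates every `m j`: inside `s i` by agreement on the overlap, outside
  -- because `m j ≤ μ`. Restricting to `s i` then kills the second summand.
  have hup : μ ≤ m i + μ.restrict (s i)ᶜ := by
    refine iSup₂_le fun j hj => Measure.le_iff.2 fun A hA => ?_
    have h1 : m j (A ∩ s i) ≤ m i A := by
      have h2 : m j (A ∩ s i) = m j (A ∩ s i ∩ s j) := by
        refine (measure_inter_conull ?_).symm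
        exact hm j hj
      rw [h2, hag j i hj hi _ ((hA.inter (hs i)).inter (hs j)) Set.inter_subset_right
        (Set.inter_subset_left.trans Set.inter_subset_right)]
      exact measure_mono (Set.inter_subset_left.trans Set.inter_subset_left)
    calc m j A = m j (A ∩ s i) + m j (A \ s i) := (measure_inter_add_sdiff A (hs i)).symm
      _ ≤ m i A + μ (A \ s i) := add_le_add h1 (hle j hj _)
      _ = (m i + μ.restrict (s i)ᶜ) A := by
        rw [Measure.add_apply, Measure.restrict_apply hA, Set.sdiff_eq]
  refine le_antisymm ?_ ?_
  · calc μ.restrict (s i) ≤ (m i + μ.restrict (s i)ᶜ).restrict (s i) :=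
        Measure.restrict_mono le_rfl hup
      _ = (m i).restrict (s i) := by
        rw [Measure.restrict_add, Measure.restrict_restrict (hs i), Set.inter_compl_self,
          Measure.restrict_empty, add_zero]
      _ ≤ m i := Measure.restrict_le_self
  · refine Measure.le_iff.2 fun A hA => ?_
    rw [Measure.restrict_apply hA, ← measure_inter_conull (hm i hi)]
    exact hle i hi _

end MeasureLemmas

/-! ### The Riemannian measure in a chart. -/

section RiemannianMeasure

variable {n N : ℕ} {S : ModelSpace N}

/-- The change of the volume density under a change of coordinates. -/
theorem volumeDensity_comp {φ : EuclideanSpace ℝ (Fin n) → EuclideanSpace ℝ (Fin N)}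
    {τ : EuclideanSpace ℝ (Fin n) → EuclideanSpace ℝ (Fin n)} {y : EuclideanSpace ℝ (Fin n)}
    (hφ : DifferentiableAt ℝ φ (τ y)) (hτ : DifferentiableAt ℝ τ y) :
    volumeDensity S (φ ∘ τ) y = |(fderiv ℝ τ y).det| * volumeDensity S φ (τ y) := by
  set b := (EuclideanSpace.basisFun (Fin n) ℝ).toBasis with hb
  set T : Matrix (Fin n) (Fin n) ℝ := LinearMap.toMatrix b b (fderiv ℝ τ y).toLinearMap with hT
  have hTe : ∀ i j, T i j = fderiv ℝ τ y (EuclideanSpace.single j 1) i := by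
    intro i j
    simp [hT, hb, LinearMap.toMatrix_apply]
  have hdet : (fderiv ℝ τ y).det = T.det := (LinearMap.det_toMatrix b _).symm
  have hmat : metricMatrix (n := n) S (φ ∘ τ) y
      = T.transpose * metricMatrix (n := n) S φ (τ y) * T := by
    ext i j
    have hm : ∀ v w, metric (n := n) S (φ ∘ τ) y v w
        = metric (n := n) S φ (τ y) (fderiv ℝ τ y v) (fderiv ℝ τ y w) := by
      intro v w
      simp only [metric_apply, differential_eq_fderiv]
      rw [fderiv_comp y hφ hτ]
      rfl
    rw [metricMatrix, Matrix.of_apply, hm, bilin_apply_eq_sum]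
    simp only [Matrix.mul_apply, Matrix.transpose_apply, hTe, metricMatrix, Matrix.of_apply,
      Finset.sum_mul]
    rw [Finset.sum_comm]
    refine Finset.sum_congr rfl fun k _ => Finset.sum_congr rfl fun l _ => ?_
    ring
  rw [volumeDensity, volumeDensity, hmat, Matrix.det_mul, Matrix.det_mul, Matrix.det_transpose,
    hdet, ← Real.sqrt_sq_eq_abs, ← Real.sqrt_mul (sq_nonneg _)]
  congr 1
  ring

variable {M : Type*} [TopologicalSpace M]
  {F : M → EuclideanSpace ℝ (Fin N)} {e e' : OpenPartialHomeomorph M (EuclideanSpace ℝ (Fin n))}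

theorem sqrt_det_gramMatrix (y : EuclideanSpace ℝ (Fin n)) :
    √(gramMatrix S F e y).det = volumeDensity S (F ∘ e.symm) y := by
  have : gramMatrix S F e y = metricMatrix (n := n) S (F ∘ e.symm) y := by
    ext i j
    simp [gramMatrix, metricMatrix, metric_apply, differential_eq_fderiv]
  rw [this]
  rfl

variable [MeasurableSpace M] [BorelSpace M]

/-- The Riemannian measure of a coordinate domain. -/
noncomputable def chartMeasure (S : ModelSpace N) (F : M → EuclideanSpace ℝ (Fin N))
    (e : OpenPartialHomeomorph M (EuclideanSpace ℝ (Fin n))) : Measure M :=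
  ((volume.restrict e.target).withDensity
    fun y => ENNReal.ofReal √(gramMatrix S F e y).det).map e.symm

theorem aemeasurable_chart_symm :
    AEMeasurable e.symm ((volume.restrict e.target).withDensity
      fun y => ENNReal.ofReal √(gramMatrix S F e y).det) :=
  (e.continuousOn_symm.aemeasurable e.open_target.measurableSet).mono_ac
    (withDensity_absolutelyContinuous _ _)

theorem chartMeasure_apply {A : Set M} (hA : MeasurableSet A) : chartMeasure S F e A =
    ∫⁻ y in e.symm ⁻¹' A ∩ e.target, ENNReal.ofReal (volumeDensity S (F ∘ e.symm) y) := by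
  rw [chartMeasure, Measure.map_apply_of_aemeasurable aemeasurable_chart_symm hA,
    withDensity_apply', Measure.restrict_restrict' e.open_target.measurableSet]
  simp_rw [sqrt_det_gramMatrix]

theorem chartMeasure_compl_source : chartMeasure S F e e.sourceᶜ = 0 := by
  have : e.symm ⁻¹' e.sourceᶜ ∩ e.target = ∅ := by
    ext y
    simpa using fun h hy => h (e.map_target hy)
  rw [chartMeasure_apply e.open_source.measurableSet.compl, this]
  simp

variable [ChartedSpace (EuclideanSpace ℝ (Fin n)) M]

/-- Change of variables along the transition map: its Jacobian is exactly the factor by which the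
volume density changes. -/
theorem chartMeasure_congr [IsManifold (𝓡 n) ∞ M]
    (hF : ContMDiff (𝓡 n) 𝓘(ℝ, EuclideanSpace ℝ (Fin N)) ∞ F)
    (he : e ∈ IsManifold.maximalAtlas (𝓡 n) ∞ M) (he' : e' ∈ IsManifold.maximalAtlas (𝓡 n) ∞ M)
    {A : Set M} (hA : MeasurableSet A) (hAe : A ⊆ e.source) (hAe' : A ⊆ e'.source) :
    chartMeasure S F e A = chartMeasure S F e' A := by
  rw [chartMeasure_apply hA, chartMeasure_apply hA]
  set s := e.symm ⁻¹' A ∩ e.target with hs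
  have hsm : MeasurableSet s :=
    measurableSet_preimage_inter e.continuousOn_symm e.open_target.measurableSet hA
  have himage : e'.symm ⁻¹' A ∩ e'.target = (e' ∘ e.symm) '' s := by
    ext y
    constructor
    · rintro ⟨hyA, hy⟩
      refine ⟨e (e'.symm y), ⟨?_, e.map_source (hAe hyA)⟩, ?_⟩
      · simpa [e.left_inv (hAe hyA)] using hyA
      · simp [e.left_inv (hAe hyA), e'.right_inv hy]
    · rintro ⟨z, ⟨hzA, hz⟩, rfl⟩
      refine ⟨?_, e'.map_source (hAe' hzA)⟩
      simpa [e'.left_inv (hAe' hzA)] using hzA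
  have hinj : Set.InjOn (e' ∘ e.symm) s := by
    rintro y ⟨hyA, hy⟩ z ⟨hzA, hz⟩ hyz
    exact e.symm.injOn hy hz (e'.injOn (hAe' hyA) (hAe' hzA) hyz)
  have hdiff : ∀ y ∈ s, DifferentiableAt ℝ (e' ∘ e.symm) y := by
    rintro y ⟨hyA, hy⟩
    have h1 := contMDiffAt_symm_of_mem_maximalAtlas he hy
    have h2 := contMDiffAt_of_mem_maximalAtlas he' (hAe' hyA)
    exact (ContMDiffAt.comp y h2 h1).contDiffAt.differentiableAt (by simp)
  rw [himage, lintegral_image_eq_lintegral_abs_det_fderiv_mul volume hsm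
    (fun y hy => (hdiff y hy).hasFDerivAt.hasFDerivWithinAt) hinj]
  refine setLIntegral_congr_fun hsm fun y hy => ?_
  have hloc : F ∘ e.symm =ᶠ[𝓝 y] (F ∘ e'.symm) ∘ (e' ∘ e.symm) := by
    have hc := e.continuousAt_symm hy.2
    filter_upwards [hc.preimage_mem_nhds (e'.open_source.mem_nhds (hAe' hy.1))] with z hz
    simp [e'.left_inv hz]
  have hval : volumeDensity S (F ∘ e.symm) y
      = volumeDensity S ((F ∘ e'.symm) ∘ (e' ∘ e.symm)) y := by
    simp only [volumeDensity, metricMatrix, metric_apply, differential_eq_fderiv, hloc.fderiv_eq]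
  have hd : DifferentiableAt ℝ (F ∘ e'.symm) ((e' ∘ e.symm) y) :=
    differentiableAt_comp_symm hF he' (hAe' hy.1)
  rw [hval, volumeDensity_comp hd (hdiff y hy), ENNReal.ofReal_mul (abs_nonneg _)]

theorem riemannianMeasure_restrict_source [IsManifold (𝓡 n) ∞ M]
    (hF : ContMDiff (𝓡 n) 𝓘(ℝ, EuclideanSpace ℝ (Fin N)) ∞ F)
    (he : e ∈ IsManifold.maximalAtlas (𝓡 n) ∞ M) :
    (riemannianMeasure (n := n) S F).restrict e.source = chartMeasure S F e :=
  restrict_biSup_eq (p := fun e => e ∈ IsManifold.maximalAtlas (𝓡 n) ∞ M)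
    (m := fun e => chartMeasure S F e) (s := fun e => e.source)
    (fun e => e.open_source.measurableSet) (fun _ _ => chartMeasure_compl_source)
    (fun _ _ h h' _ hA hAe hAe' => chartMeasure_congr hF h h' hA hAe hAe') he

/-- Integrals over a coordinate domain in coordinates. -/
theorem setIntegral_source_riemannianMeasure [IsManifold (𝓡 n) ∞ M]
    (hF : ContMDiff (𝓡 n) 𝓘(ℝ, EuclideanSpace ℝ (Fin N)) ∞ F)
    (he : e ∈ IsManifold.maximalAtlas (𝓡 n) ∞ M) {h : M → ℝ}
    (hh : ContinuousOn (h ∘ e.symm) e.target)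
    (hρ : ContinuousOn (volumeDensity S (F ∘ e.symm)) e.target) :
    ∫ x in e.source, h x ∂(riemannianMeasure (n := n) S F)
      = ∫ y in e.target, h (e.symm y) * volumeDensity S (F ∘ e.symm) y := by
  have hhe : ContinuousOn h e.source := by
    refine (hh.comp e.continuousOn e.mapsTo).congr fun x hx => ?_
    simp [e.left_inv hx]
  have hmeas : AEStronglyMeasurable h (chartMeasure S F e) := by
    rw [← Measure.restrict_eq_self_of_ae_mem (s := e.source) (μ := chartMeasure S F e)
      (mem_ae_iff.2 chartMeasure_compl_source)]
    exact hhe.aestronglyMeasurable e.open_source.measurableSet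
  rw [riemannianMeasure_restrict_source hF he]
  rw [chartMeasure] at hmeas ⊢
  rw [integral_map aemeasurable_chart_symm hmeas]
  simp_rw [sqrt_det_gramMatrix]
  rw [integral_withDensity_eq_integral_toReal_smul₀
    (hρ.aemeasurable e.open_target.measurableSet).ennreal_ofReal
    (ae_of_all _ fun _ => ENNReal.ofReal_lt_top)]
  refine integral_congr_ae (ae_of_all _ fun y => ?_)
  simp only [smul_eq_mul]
  rw [ENNReal.toReal_ofReal (show 0 ≤ volumeDensity S (F ∘ e.symm) y from Real.sqrt_nonneg _),
    mul_comm]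

end RiemannianMeasure


/-! ### Continuity of the Ricci term. -/

section Potential

variable {N : ℕ} {S : ModelSpace N}

/-- The connection depends smoothly on smooth families of vector fields. -/
theorem contDiff_connection {P : Type*} [NormedAddCommGroup P] [NormedSpace ℝ P]
    (hproj : ContDiff ℝ ∞ S.proj)
    {X Y : P → EuclideanSpace ℝ (Fin N) → EuclideanSpace ℝ (Fin N)}
    (hX : ContDiff ℝ ∞ (Function.uncurry X)) (hY : ContDiff ℝ ∞ (Function.uncurry Y)) :
    ContDiff ℝ ∞ (Function.uncurry fun p => connection S (X p) (Y p)) := by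
  have hd : ContDiff ℝ ∞ fun q : P × EuclideanSpace ℝ (Fin N) => fderiv ℝ (Y q.1) q.2 :=
    ContDiff.fderiv (f := fun q : P × EuclideanSpace ℝ (Fin N) => Y q.1) (m := ∞)
      (hY.comp ((contDiff_fst.comp contDiff_fst).prodMk contDiff_snd)) contDiff_snd (by simp)
  exact (hproj.comp contDiff_snd).clm_apply (hd.clm_apply hX)

theorem contDiff_lieBracket {P : Type*} [NormedAddCommGroup P] [NormedSpace ℝ P]
    {X Y : P → EuclideanSpace ℝ (Fin N) → EuclideanSpace ℝ (Fin N)}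
    (hX : ContDiff ℝ ∞ (Function.uncurry X)) (hY : ContDiff ℝ ∞ (Function.uncurry Y)) :
    ContDiff ℝ ∞ (Function.uncurry fun p => VectorField.lieBracket ℝ (X p) (Y p)) := by
  have hd : ∀ {Z : P → EuclideanSpace ℝ (Fin N) → EuclideanSpace ℝ (Fin N)},
      ContDiff ℝ ∞ (Function.uncurry Z) →
      ContDiff ℝ ∞ fun q : P × EuclideanSpace ℝ (Fin N) => fderiv ℝ (Z q.1) q.2 := fun {Z} hZ =>
    ContDiff.fderiv (f := fun q : P × EuclideanSpace ℝ (Fin N) => Z q.1) (m := ∞)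
      (hZ.comp ((contDiff_fst.comp contDiff_fst).prodMk contDiff_snd)) contDiff_snd (by simp)
  exact ((hd hY).clm_apply hX).sub ((hd hX).clm_apply hY)

/-- `ricci` differentiates fields built from `u` and `w`. Treating `(u, w)` as a parameter makes
every field jointly smooth in parameter and point, a property that the connection and the bracket
preserve. -/
theorem continuous_ricci (hproj : ContDiff ℝ ∞ S.proj) :
    Continuous fun q : (EuclideanSpace ℝ (Fin N) × EuclideanSpace ℝ (Fin N)) ×
      EuclideanSpace ℝ (Fin N) => ricci S q.2 q.1.1 q.1.2 := by
  have hfield : ∀ {w : EuclideanSpace ℝ (Fin N) × EuclideanSpace ℝ (Fin N) →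
      EuclideanSpace ℝ (Fin N)}, ContDiff ℝ ∞ w →
      ContDiff ℝ ∞ (Function.uncurry fun p => tangentField S (w p)) := fun {w} hw =>
    (hproj.comp contDiff_snd).clm_apply (hw.comp contDiff_fst)
  have hu := hfield contDiff_fst
  have hw := hfield contDiff_snd
  refine continuous_finsetSum _ fun i _ => ?_
  have hi := hfield (w := fun _ => EuclideanSpace.single i 1) contDiff_const
  have hR := ((contDiff_connection hproj hi (contDiff_connection hproj hu hw)).sub
    (contDiff_connection hproj hu (contDiff_connection hproj hi hw))).sub
      (contDiff_connection hproj (contDiff_lieBracket hi hu) hw)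
  exact (EuclideanSpace.proj i : EuclideanSpace ℝ (Fin N) →L[ℝ] ℝ).continuous.comp hR.continuous

end Potential

/-! ### Strongly stable neighbourhoods on the manifold. -/

section Stability

variable {n N : ℕ} {M : Type*} [TopologicalSpace M]
  [ChartedSpace (EuclideanSpace ℝ (Fin n)) M] {S : ModelSpace N}
  {F ν : M → EuclideanSpace ℝ (Fin N)}

/-- The expression in a chart of a function with compact support in the domain of the chart. -/
theorem contDiff_indicator_comp_symm {e : OpenPartialHomeomorph M (EuclideanSpace ℝ (Fin n))}
    (he : e ∈ IsManifold.maximalAtlas (𝓡 n) ∞ M) {f : M → ℝ}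
    (hf : ContMDiff (𝓡 n) 𝓘(ℝ, ℝ) ∞ f) (hc : HasCompactSupport f) (hs : tsupport f ⊆ e.source) :
    ContDiff ℝ ∞ (e.target.indicator (f ∘ e.symm)) ∧
      HasCompactSupport (e.target.indicator (f ∘ e.symm)) ∧
      tsupport (e.target.indicator (f ∘ e.symm)) ⊆ e '' tsupport f := by
  have hK : IsCompact (e '' tsupport f) := hc.image_of_continuousOn (e.continuousOn.mono hs)
  have h0 : ∀ y, y ∉ e '' tsupport f → e.target.indicator (f ∘ e.symm) y = 0 := by
    intro y hy
    by_cases hyt : y ∈ e.target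
    · rw [Set.indicator_of_mem hyt]
      exact image_eq_zero_of_notMem_tsupport (f := f) fun hmem => hy ⟨_, hmem, e.right_inv hyt⟩
    · rw [Set.indicator_of_notMem hyt]
  have hts : tsupport (e.target.indicator (f ∘ e.symm)) ⊆ e '' tsupport f :=
    closure_minimal (fun y hy => by
      by_contra hyK
      exact hy (h0 y hyK)) hK.isClosed
  refine ⟨contDiff_iff_contDiffAt.2 fun y => ?_, HasCompactSupport.intro hK h0, hts⟩
  by_cases hy : y ∈ tsupport (e.target.indicator (f ∘ e.symm))
  swap
  · exact contDiffAt_const.congr_of_eventuallyEq (notMem_tsupport_iff_eventuallyEq.1 hy)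
  have hyt : y ∈ e.target := by
    obtain ⟨x, hx, rfl⟩ := hts hy
    exact e.map_source (hs hx)
  refine ((contDiffOn_comp_symm hf he).contDiffAt
    (e.open_target.mem_nhds hyt)).congr_of_eventuallyEq ?_
  filter_upwards [e.open_target.mem_nhds hyt] with z hz
  exact Set.indicator_of_mem hz _

variable [IsManifold (𝓡 n) ∞ M] [MeasurableSpace M] [BorelSpace M]

/-- Every point of a spacelike hypersurface has a strongly stable neighbourhood. -/
theorem exists_stronglyStable_nhds (hn : 1 ≤ n) (hS : ∀ a b, S.form a b = S.form b a)
    (hproj : ContDiff ℝ ∞ S.proj) (hM : IsOrientedHypersurface (n := n) S F ν)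
    (hsp : ∀ x, IsSpacelikeAt (n := n) S F x) (p : M) :
    ∃ U : Set M, IsOpen U ∧ p ∈ U ∧ StronglyStable (n := n) S F ν U := by
  set e := chartAt (EuclideanSpace ℝ (Fin n)) p with he_def
  have he : e ∈ IsManifold.maximalAtlas (𝓡 n) ∞ M := IsManifold.chart_mem_maximalAtlas p
  have hp : e p ∈ e.target := mem_chart_target _ p
  have hO := e.open_target
  have hφ := contDiffOn_comp_symm hM.smooth he
  have hν := contDiffOn_comp_symm hM.normal_smooth he
  have hspe := isSpacelikeAt_comp_symm_of_mem_target hsp hM.smooth he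
  set V : EuclideanSpace ℝ (Fin n) → ℝ := fun y =>
    ricci S (F (e.symm y)) (ν (e.symm y)) (ν (e.symm y)) + LinearMap.trace ℝ _
      ((weingarten (n := n) S (F ∘ e.symm) (ν ∘ e.symm) y).comp
        (weingarten (n := n) S (F ∘ e.symm) (ν ∘ e.symm) y)).toLinearMap with hVdef
  have hV : ContinuousOn V e.target := by
    refine ContinuousOn.add ?_ ?_
    · exact (continuous_ricci hproj).comp_continuousOn
        (f := fun y => (((ν ∘ e.symm) y, (ν ∘ e.symm) y), (F ∘ e.symm) y))
        ((hν.continuousOn.prodMk hν.continuousOn).prodMk hφ.continuousOn)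
    · have hw : ContDiffOn ℝ ∞
          (fun y => weingarten (n := n) S (F ∘ e.symm) (ν ∘ e.symm) y) e.target :=
        (contDiffOn_covariantDeriv hO hφ hspe hν).neg
      have hww := contDiffOn_trace (hw.clm_comp hw)
      exact hww.continuousOn
  -- `1 ≤ n` supplies the coordinate direction used in Poincaré's inequality.
  obtain ⟨r, hr, hrO, hstab⟩ := exists_ball_integral_neg hO hφ hspe hS hV ⟨0, hn⟩ hp
  refine ⟨e.source ∩ e ⁻¹' Metric.ball (e p) r, e.isOpen_inter_preimage Metric.isOpen_ball,
    ⟨mem_chart_source _ p, Metric.mem_ball_self hr⟩, ?_⟩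
  intro Ω hΩU hΩo hΩc f hf hc hsupp hne _
  have hfs : tsupport f ⊆ e.source := fun x hx => (hΩU (hsupp hx)).1
  obtain ⟨hu, huc, hus⟩ := contDiff_indicator_comp_symm he hf hc hfs
  set u := e.target.indicator (f ∘ e.symm) with hudef
  have hfu : ∀ x ∈ e.source, f x = u (e x) := fun x hx => by
    rw [hudef, Set.indicator_of_mem (e.map_source hx), Function.comp_apply, e.left_inv hx]
  have hub : tsupport u ⊆ Metric.ball (e p) r := fun y hy => by
    obtain ⟨x, hx, rfl⟩ := hus hy
    exact (hΩU (hsupp hx)).2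
  have hune : ∃ y, u y ≠ 0 := by
    obtain ⟨x, hx⟩ := hne
    exact ⟨e x, by rwa [← hfu x (hfs (subset_tsupport _ hx))]⟩
  have hval : ∀ y ∈ e.target, f (e.symm y) * stabilityOperator (n := n) S F ν f (e.symm y)
      = u y * (laplacian (n := n) S (F ∘ e.symm) u y + V y * u y) := by
    intro y hy
    have hx := e.map_target hy
    rw [stabilityOperator, laplacian_chart hsp hM.smooth he hx hu hfu,
      trace_weingarten_sq_chart (hsp _) hM.smooth hM.normal_smooth he hx, hfu _ hx,
      e.right_inv hy]
    ring
  have hzero : ∀ x, x ∉ tsupport f → f x * stabilityOperator (n := n) S F ν f x = 0 := fun x hx => by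
    rw [image_eq_zero_of_notMem_tsupport hx, zero_mul]
  have hρ := contDiffOn_volumeDensity hO hφ hspe hS
  have hcont : ContinuousOn ((fun x => f x * stabilityOperator (n := n) S F ν f x) ∘ e.symm)
      e.target := by
    refine ContinuousOn.congr ?_ hval
    exact hu.continuous.continuousOn.mul
      ((contDiffOn_laplacian hO hφ hspe hu.contDiffOn).continuousOn.add
        (hV.mul hu.continuous.continuousOn))
  -- The integrand vanishes off `tsupport f`, so `Ω` can be exchanged for `M` and then for the chart
  -- domain, where the integral is computed in coordinates.
  rw [setIntegral_eq_integral_of_forall_compl_eq_zero fun x hx => hzero x fun h => hx (hsupp h),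
    ← setIntegral_eq_integral_of_forall_compl_eq_zero (s := e.source)
      fun x hx => hzero x fun h => hx (hfs h),
    setIntegral_source_riemannianMeasure hM.smooth he hcont hρ.continuousOn,
    setIntegral_congr_fun (g := fun y => u y * ((laplacian (n := n) S (F ∘ e.symm) u y + V y * u y)
      * volumeDensity S (F ∘ e.symm) y)) hO.measurableSet fun y hy => by
        simp only [hval y hy, mul_assoc],
    setIntegral_eq_integral_of_forall_compl_eq_zero fun y hy => by
      rw [hudef, Set.indicator_of_notMem hy, zero_mul]]
  exact hstab u hu huc hub hune

end Stability

/-! ### Verification for the three space forms. -/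

section SpaceForms

variable {n N : ℕ} {M : Type*} [TopologicalSpace M] [ChartedSpace (EuclideanSpace ℝ (Fin n)) M]

theorem dot_comm (a b : EuclideanSpace ℝ (Fin N)) : dot N a b = dot N b a := by
  simp only [dot_apply, mul_comm]

theorem lorentz_comm (a b : EuclideanSpace ℝ (Fin (n + 2))) : lorentz n a b = lorentz n b a := by
  simp only [lorentz_apply, mul_comm]

theorem contDiff_proj_spherical : ContDiff ℝ ∞ (spherical n).proj := by
  rw [contDiff_clm_apply_iff]
  intro v
  exact contDiff_const.sub (((dot (n + 2)).contDiff.clm_apply contDiff_const).smul contDiff_id)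

theorem contDiff_proj_hyperbolic : ContDiff ℝ ∞ (hyperbolic n).proj := by
  rw [contDiff_clm_apply_iff]
  intro v
  exact contDiff_const.add (((lorentz n).contDiff.clm_apply contDiff_const).smul contDiff_id)

theorem isSpacelikeAt_of_form_eq_dot {S : ModelSpace N} (hS : S.form = dot N)
    {F : M → EuclideanSpace ℝ (Fin N)} {x : M}
    (hF : Function.Injective (differential (n := n) F x)) : IsSpacelikeAt (n := n) S F x := by
  intro v hv
  have hne : differential F x v ≠ 0 := fun h => hv (hF (by rw [h, map_zero]))
  rw [hS]
  exact real_inner_self_pos.2 hne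

/-- The Lorentz form is positive definite on the orthogonal complement of a timelike vector. -/
theorem lorentz_pos_of_orthogonal {x w : EuclideanSpace ℝ (Fin (n + 2))} (hx : lorentz n x x = -1)
    (hxw : lorentz n x w = 0) (hw : w ≠ 0) : 0 < lorentz n w w := by
  rw [lorentz_apply] at *
  by_contra! hle
  -- Let `a`, `b` be the squared spatial norms of `x`, `w`. Cauchy-Schwarz and orthogonality give
  -- `(1 + a) w₀² ≤ a b`, while `b ≤ w₀²` is assumed for contradiction; hence `w₀ = 0` and `b = 0`.
  have hcs := Finset.sum_mul_sq_le_sq_mul_sq Finset.univ (fun i : Fin (n + 1) => x i.succ)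
    fun i => w i.succ
  simp only [← sq] at hx hle
  have hb : 0 ≤ ∑ i : Fin (n + 1), w i.succ ^ 2 := Finset.sum_nonneg fun i _ => sq_nonneg _
  have ha : 0 ≤ ∑ i : Fin (n + 1), x i.succ ^ 2 := Finset.sum_nonneg fun i _ => sq_nonneg _
  have h1 : ∑ i : Fin (n + 1), x i.succ * w i.succ = x 0 * w 0 := by linarith
  rw [h1] at hcs
  generalize ∑ i : Fin (n + 1), x i.succ ^ 2 = a at *
  have h2 : x 0 ^ 2 = 1 + a := by linarith
  rw [mul_pow, h2] at hcs
  have h3 : w 0 ^ 2 ≤ 0 := by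
    have := mul_le_mul_of_nonneg_left (show ∑ i : Fin (n + 1), w i.succ ^ 2 ≤ w 0 ^ 2 by linarith) ha
    linarith
  have h4 : ∑ i : Fin (n + 1), w i.succ ^ 2 = 0 := by linarith
  refine hw ?_
  ext i
  refine Fin.cases ?_ (fun j => ?_) i
  · simpa using le_antisymm h3 (sq_nonneg _)
  · simpa using (Finset.sum_eq_zero_iff_of_nonneg fun j _ => sq_nonneg _).1 h4 j
      (Finset.mem_univ j)

/-- Differentiating `⟨F, F⟩ = -1` shows that the image of `dF` is Lorentz-orthogonal to the timelike
vector `F x`. -/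
theorem isSpacelikeAt_hyperbolic {F : M → EuclideanSpace ℝ (Fin (n + 2))}
    (hF : ContMDiff (𝓡 n) 𝓘(ℝ, EuclideanSpace ℝ (Fin (n + 2))) ∞ F)
    (hmem : ∀ x, F x ∈ (hyperbolic n).carrier) {x : M}
    (himm : Function.Injective (differential (n := n) F x)) :
    IsSpacelikeAt (n := n) (hyperbolic n) F x := by
  intro v hv
  have hne : differential F x v ≠ 0 := fun h => hv (himm (by rw [h, map_zero]))
  refine lorentz_pos_of_orthogonal (hmem x).1 ?_ hne
  have hq : HasFDerivAt (fun z => lorentz n z z) _ (F x) :=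
    (lorentz n).hasFDerivAt.clm_apply (hasFDerivAt_id (F x))
  have hcomp := mfderiv_comp x (I := 𝓡 n) (I' := 𝓘(ℝ, EuclideanSpace ℝ (Fin (n + 2))))
    (I'' := 𝓘(ℝ, ℝ)) hq.differentiableAt.mdifferentiableAt (hF.mdifferentiable (by simp) x)
  have hconst : (fun z => lorentz n z z) ∘ F = fun _ => (-1 : ℝ) := funext fun z => (hmem z).1
  rw [hconst, mfderiv_const, mfderiv_eq_fderiv, hq.fderiv] at hcomp
  have h2 : (0 : ℝ) = lorentz n (F x) (differential F x v)
      + lorentz n (differential F x v) (F x) := congrArg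
    (fun A : EuclideanSpace ℝ (Fin n) →L[ℝ] ℝ => A v) hcomp
  rw [lorentz_comm (differential F x v)] at h2
  linarith

theorem exists_isHorosphere : ∃ A : Set (EuclideanSpace ℝ (Fin (n + 2))), IsHorosphere n A := by
  -- The sum of the time axis and one space axis is null and future-pointing.
  refine ⟨_, EuclideanSpace.single 0 1 + EuclideanSpace.single (Fin.succ 0) 1, ?_, ?_, rfl⟩
  · rw [lorentz_apply, Fin.sum_univ_succ]
    simp [-Fin.succ_zero_eq_one, -Fin.succ_zero_eq_one', Fin.succ_inj, Fin.succ_ne_zero]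
  · simp

end SpaceForms

end SpaceFormStability

/-! ### The theorem for all three space forms. -/

theorem mainTheorem4 (n : ℕ) (hn : 1 ≤ n) {M : Type*} [TopologicalSpace M] [T2Space M]
    [SecondCountableTopology M] [ChartedSpace (EuclideanSpace ℝ (Fin n)) M]
    [IsManifold (𝓡 n) ∞ M] [MeasurableSpace M] [BorelSpace M] :
    (∀ F ν : M → EuclideanSpace ℝ (Fin (n + 1)),
      SpaceFormStability.IsOrientedHypersurface (n := n) (SpaceFormStability.euclidean n) F ν →
      SpaceFormStability.HasConstantMeanCurvature (n := n) (SpaceFormStability.euclidean n) F ν →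
      ∀ p : M, ∃ U : Set M, IsOpen U ∧ p ∈ U ∧
        SpaceFormStability.StronglyStable (n := n) (SpaceFormStability.euclidean n) F ν U) ∧
    (∀ F ν : M → EuclideanSpace ℝ (Fin (n + 2)),
      SpaceFormStability.IsOrientedHypersurface (n := n) (SpaceFormStability.spherical n) F ν →
      SpaceFormStability.HasConstantMeanCurvature (n := n) (SpaceFormStability.spherical n) F ν →
      ∀ p : M, ∃ U : Set M, IsOpen U ∧ p ∈ U ∧
        SpaceFormStability.StronglyStable (n := n) (SpaceFormStability.spherical n) F ν U) ∧
    (∀ F ν : M → EuclideanSpace ℝ (Fin (n + 2)),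
      SpaceFormStability.IsOrientedHypersurface (n := n) (SpaceFormStability.hyperbolic n) F ν →
      SpaceFormStability.HasConstantMeanCurvature (n := n) (SpaceFormStability.hyperbolic n) F ν →
      (¬ ∃ A : Set (EuclideanSpace ℝ (Fin (n + 2))),
        SpaceFormStability.IsHorosphere n A ∧ Set.range F ⊆ A) →
      ∃ p : M, ∃ U : Set M, IsOpen U ∧ p ∈ U ∧
        SpaceFormStability.StronglyStable (n := n) (SpaceFormStability.hyperbolic n) F ν U) := by
  refine ⟨fun F ν hM _ p => ?_, fun F ν hM _ p => ?_, fun F ν hM _ hA => ?_⟩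
  · exact SpaceFormStability.exists_stronglyStable_nhds hn SpaceFormStability.dot_comm
      contDiff_const hM
      (fun x => SpaceFormStability.isSpacelikeAt_of_form_eq_dot rfl (hM.immersion x)) p
  · exact SpaceFormStability.exists_stronglyStable_nhds hn SpaceFormStability.dot_comm
      SpaceFormStability.contDiff_proj_spherical hM
      (fun x => SpaceFormStability.isSpacelikeAt_of_form_eq_dot rfl (hM.immersion x)) p
  -- For empty `M` the range of `F` is empty and lies in any horosphere, contrary to assumption.
  · have hne : Nonempty M := by
      by_contra hempty
      rw [not_nonempty_iff] at hempty
      obtain ⟨A, hAh⟩ := SpaceFormStability.exists_isHorosphere (n := n)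
      exact hA ⟨A, hAh, by simp [Set.range_eq_empty F]⟩
    obtain ⟨p⟩ := hne
    exact ⟨p, SpaceFormStability.exists_stronglyStable_nhds hn SpaceFormStability.lorentz_comm
      SpaceFormStability.contDiff_proj_hyperbolic hM (fun x =>
        SpaceFormStability.isSpacelikeAt_hyperbolic hM.smooth hM.mem_carrier (hM.immersion x)) p⟩
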